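/- Let $k$ be a field of characteristic $0$, $K=k[[h]]$, and let $\widehat\otimes$ denote the $h$-adically completed tensor product over $K$. Let $A_0$ be a noetherian $k$-algebra such that $A_0\otimes_k A_0^{op}$ is noetherian, and let $A_h$ be a deformation of $A_0$: a $K$-algebra which is isomorphic to $V[[h]]$ as a $K$-module for some $k$-vector space $V$, together with an isomorphism of $k$-algebras $A_h/hA_h\simeq A_0$. Assume that $A_h$ is a topological Hopf algebra, with coproduct $\Delta:A_h\to A_h\widehat\otimes A_h$, counit $\epsilon:A_h\to K$ and antipode $S:A_h\to A_h$, and that $S$ is bijective. Let $A_h$ act on $K$ through $\epsilon$ and let $A_0$ act on $k$ through the character $\epsilon_0:A_0\to k$ which is the reduction of $\epsilon$ modulo $h$. Assume that there is an integer $d\ge 0$ such that $\mathrm{Ext}^i_{A_0}(k,A_0)=0$ for $i\neq d$ and $\mathrm{Ext}^d_{A_0}(k,A_0)\simeq k$ (as $k$-vector spaces). Write $\Omega_{A_h}=\mathrm{Ext}^d_{A_h}(K,A_h)$, a right $A_h$-module through right multiplication on $A_h$. Put $\widehat{A_h^e}=A_h\widehat\otimes A_h^{op}$; for a left $\widehat{A_h^e}$-module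 $M$ write $\alpha\cdot m\cdot\beta=(\alpha\otimes\beta)m$ and $HH^i_{A_h}(M)=\mathrm{Ext}^i_{\widehat{A_h^e}}(A_h,M)$, where $\alpha\cdot u\cdot\beta=\alpha u\beta$ on $A_h$. Consider $A_h\widehat\otimes A_h$ with the $\widehat{A_h^e}$-module structure $\alpha\cdot(x\otimes y)\cdot\beta=\alpha x\otimes y\beta$. Then: a) $HH^i_{A_h}(A_h\widehat\otimes A_h)=0$ for all $i\neq d$. b) $\Omega_{A_h}$ is a free $K$-module of rank one, so that $A_h$ acts on it by a character $\theta_{A_h}:A_h\to K$, $\omega\cdot a=\theta_{A_h}(a)\,\omega$. Give $HH^d_{A_h}(A_h\widehat\otimes A_h)$ the $\widehat{A_h^e}$-module structure induced, by functoriality, by the structure $\alpha\cdot(x\otimes y)\cdot\beta=x\beta\otimes\alpha y$ on $A_h\widehat\otimes A_h$, which commutes with the one above. Then the $\widehat{A_h^e}$-module $HH^d_{A_h}(A_h\widehat\otimes A_h)$ is isomorphic to $\Omega_{A_h}\otimes_K A_h$ with the $\widehat{A_h^e}$-module structure that extends, $h$-adically continuously, $$\alpha\cdot(\omega\otimes x)\cdot\beta=\sum_i\theta_{A_h}(\beta_i')\,\omega\otimes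 S(\beta_i'')\,x\,S^{-1}(\alpha),$$ where $\Delta(\beta)=\sum_i\beta_i'\otimes\beta_i''$ (in the topological sense). -/

import Mathlib

open scoped TensorProduct PowerSeries
open CategoryTheory

universe u

namespace QDuality

noncomputable section

/-! ### Topologically free modules over `K = k⟦h⟧` -/

/-- The ideal `(h)` of `K = k⟦h⟧`; the variable `h` is written `PowerSeries.X`. -/
abbrev hIdeal (k : Type u) [Field k] : Ideal k⟦X⟧ := Ideal.span {PowerSeries.X}

/-- `V⟦h⟧`: formal power series `∑ vₙ hⁿ` with coefficients in a vector space `V`. -/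
@[ext]
structure FormalSeries (V : Type u) : Type u where
  coeff : ℕ → V

namespace FormalSeries

variable {k V : Type u} [Field k] [AddCommGroup V] [Module k V]

instance : Zero (FormalSeries V) := ⟨⟨0⟩⟩

instance : Add (FormalSeries V) := ⟨fun v w => ⟨v.coeff + w.coeff⟩⟩

instance : Neg (FormalSeries V) := ⟨fun v => ⟨-v.coeff⟩⟩

instance : Sub (FormalSeries V) := ⟨fun v w => ⟨v.coeff - w.coeff⟩⟩

theorem coeff_add (v w : FormalSeries V) (n : ℕ) :
    (v + w).coeff n = v.coeff n + w.coeff n := rfl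

theorem coeff_zero (n : ℕ) : (0 : FormalSeries V).coeff n = 0 := rfl

theorem coeff_sub (v w : FormalSeries V) (n : ℕ) :
    (v - w).coeff n = v.coeff n - w.coeff n := rfl

theorem coeff_neg (v : FormalSeries V) (n : ℕ) : (-v).coeff n = -v.coeff n := rfl

instance : AddCommGroup (FormalSeries V) where
  add_assoc u v w := by ext n; simp [coeff_add, add_assoc]
  zero_add v := by ext n; simp [coeff_add, coeff_zero]
  add_zero v := by ext n; simp [coeff_add, coeff_zero]
  add_comm v w := by ext n; simp [coeff_add, add_comm]
  neg_add_cancel v := by ext n; simp [coeff_add, coeff_neg, coeff_zero]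
  sub_eq_add_neg v w := by ext n; simp [coeff_add, coeff_neg, coeff_sub, sub_eq_add_neg]
  nsmul := nsmulRec
  zsmul := zsmulRec

/-- `k⟦h⟧` acts on `V⟦h⟧` by the Cauchy product. -/
instance : SMul k⟦X⟧ (FormalSeries V) where
  smul f v :=
    ⟨fun n => ∑ p ∈ Finset.HasAntidiagonal.antidiagonal n, PowerSeries.coeff p.1 f • v.coeff p.2⟩

theorem coeff_smul (f : k⟦X⟧) (v : FormalSeries V) (n : ℕ) : (f • v).coeff n =
    ∑ p ∈ Finset.HasAntidiagonal.antidiagonal n, PowerSeries.coeff p.1 f • v.coeff p.2 := rfl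

instance : Module k⟦X⟧ (FormalSeries V) where
  one_smul v := by
    ext n
    rw [coeff_smul, Finset.sum_eq_single (0, n)]
    · simp
    · rintro ⟨i, j⟩ hij hne
      have : i ≠ 0 := by
        rintro rfl
        simp at hij
        exact hne (by rw [hij])
      simp [PowerSeries.coeff_one, this]
    · simp
  mul_smul f g v := by
    ext n
    simp only [coeff_smul, PowerSeries.coeff_mul, Finset.sum_smul, Finset.smul_sum, mul_smul]
    rw [Finset.sum_sigma', Finset.sum_sigma']
    refine Finset.sum_nbij' (fun x => ⟨(x.2.1, x.2.2 + x.1.2), (x.2.2, x.1.2)⟩)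
      (fun x => ⟨(x.1.1 + x.2.1, x.2.2), (x.1.1, x.2.1)⟩) ?_ ?_ ?_ ?_ ?_
    · rintro ⟨⟨a, b⟩, ⟨c, d⟩⟩ h
      simp at h ⊢
      omega
    · rintro ⟨⟨a, b⟩, ⟨c, d⟩⟩ h
      simp at h ⊢
      omega
    · rintro ⟨⟨a, b⟩, ⟨c, d⟩⟩ h
      simp at h ⊢
      omega
    · rintro ⟨⟨a, b⟩, ⟨c, d⟩⟩ h
      simp at h ⊢
      omega
    · rintro ⟨⟨a, b⟩, ⟨c, d⟩⟩ h
      rfl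
  smul_zero f := by
    ext n
    simp [coeff_smul, coeff_zero]
  smul_add f v w := by
    ext n
    simp [coeff_smul, coeff_add, smul_add, Finset.sum_add_distrib]
  add_smul f g v := by
    ext n
    simp [coeff_smul, coeff_add, add_smul, Finset.sum_add_distrib]
  zero_smul v := by
    ext n
    simp [coeff_smul, coeff_zero]

theorem mem_pow_iff (n : ℕ) (v : FormalSeries V) :
    v ∈ (hIdeal k ^ n • ⊤ : Submodule k⟦X⟧ (FormalSeries V)) ↔ ∀ i < n, v.coeff i = 0 := by
  rw [hIdeal, Ideal.span_singleton_pow, Submodule.ideal_span_singleton_smul,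
    Submodule.mem_smul_pointwise_iff_exists]
  constructor
  · rintro ⟨w, -, rfl⟩ i hi
    rw [coeff_smul]
    refine Finset.sum_eq_zero ?_
    rintro ⟨a, b⟩ hab
    have : a ≠ n := by
      simp at hab
      omega
    simp [PowerSeries.coeff_X_pow, this]
  · intro h
    refine ⟨⟨fun i => v.coeff (i + n)⟩, trivial, ?_⟩
    ext m
    rw [coeff_smul]
    by_cases hm : m < n
    · rw [h m hm]
      refine Finset.sum_eq_zero ?_
      rintro ⟨a, b⟩ hab
      have : a ≠ n := by
        simp at hab
        omega
      simp [PowerSeries.coeff_X_pow, this]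
    · rw [Finset.sum_eq_single (n, m - n)]
      · simp [PowerSeries.coeff_X_pow, Nat.sub_add_cancel (not_lt.mp hm)]
      · rintro ⟨a, b⟩ hab hne
        have : a ≠ n := by
          rintro rfl
          simp at hab
          exact hne (by rw [← hab]; simp)
        simp [PowerSeries.coeff_X_pow, this]
      · intro hn
        exact absurd (by simp; omega) hn

instance : IsAdicComplete (hIdeal k) (FormalSeries V) where
  haus' v hv := by
    ext i
    have := hv (i + 1)
    rw [SModEq.sub_mem, mem_pow_iff] at this
    simpa [coeff_sub, coeff_zero] using this i (Nat.lt_succ_self i)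
  prec' f hf := by
    refine ⟨⟨fun i => (f (i + 1)).coeff i⟩, fun n => ?_⟩
    rw [SModEq.sub_mem, mem_pow_iff]
    intro i hi
    have := hf (m := i + 1) (n := n) hi
    rw [SModEq.sub_mem, mem_pow_iff] at this
    have h := this i (Nat.lt_succ_self i)
    rw [coeff_sub] at h ⊢
    rw [← neg_eq_zero, neg_sub]
    exact h

end FormalSeries

/-- A `k⟦h⟧`-module is topologically free if it is isomorphic to `V⟦h⟧` for a `k`-vector space
`V`. -/
class IsTopologicallyFree (k M : Type u) [Field k] [AddCommGroup M] [Module k⟦X⟧ M] : Prop where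
  exists_equiv : ∃ (V : Type u) (_ : AddCommGroup V) (_ : Module k V),
    Nonempty (M ≃ₗ[k⟦X⟧] FormalSeries V)

instance (k M : Type u) [Field k] [AddCommGroup M] [Module k⟦X⟧ M] [IsTopologicallyFree k M] :
    IsAdicComplete (hIdeal k) M := by
  obtain ⟨V, _, _, ⟨e⟩⟩ := IsTopologicallyFree.exists_equiv (k := k) (M := M)
  rw [← AdicCompletion.of_bijective_iff]
  have h : (AdicCompletion.of (hIdeal k) M : M → AdicCompletion (hIdeal k) M) =
      (AdicCompletion.congr (hIdeal k) e).symm ∘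
        (AdicCompletion.of (hIdeal k) (FormalSeries V)) ∘ e := by
    funext x
    rw [Function.comp_apply, Function.comp_apply, LinearEquiv.eq_symm_apply,
      AdicCompletion.congr_apply, AdicCompletion.map_of]
    rfl
  rw [h]
  exact (LinearEquiv.bijective _).comp
    ((AdicCompletion.of_bijective (hIdeal k) (FormalSeries V)).comp e.bijective)

/-! ### `h`-adic completion: extension of linear maps, and the ring structure -/

section Completion

variable {k : Type u} [Field k]

theorem hIdeal_fg : (hIdeal k).FG := ⟨{PowerSeries.X}, by simp [hIdeal]⟩

instance (M : Type u) [AddCommGroup M] [Module k⟦X⟧ M] :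
    IsAdicComplete (hIdeal k) (AdicCompletion (hIdeal k) M) :=
  AdicCompletion.isAdicComplete hIdeal_fg

variable {M N P Q : Type u} [AddCommGroup M] [Module k⟦X⟧ M] [AddCommGroup N] [Module k⟦X⟧ N]
  [AddCommGroup P] [Module k⟦X⟧ P] [AddCommGroup Q] [Module k⟦X⟧ Q]

/-- Two `K`-linear maps from a completion to a separated module agree if they agree on the
image of the module that is completed. -/
theorem completion_hom_ext [IsHausdorff (hIdeal k) Q]
    {f g : AdicCompletion (hIdeal k) M →ₗ[k⟦X⟧] Q}
    (h : ∀ m, f (AdicCompletion.of (hIdeal k) M m) = g (AdicCompletion.of (hIdeal k) M m)) :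
    f = g := by
  refine LinearMap.ext fun x => ?_
  rw [← sub_eq_zero, ← LinearMap.sub_apply]
  refine IsHausdorff.haus ‹IsHausdorff (hIdeal k) Q› _ fun n => ?_
  rw [SModEq.zero]
  obtain ⟨y, hy⟩ := Submodule.mkQ_surjective _ (AdicCompletion.eval (hIdeal k) M n x)
  have hx : x - AdicCompletion.of (hIdeal k) M y ∈
      (hIdeal k ^ n • ⊤ : Submodule k⟦X⟧ (AdicCompletion (hIdeal k) M)) := by
    rw [AdicCompletion.pow_smul_top_eq_ker_eval hIdeal_fg, LinearMap.mem_ker, map_sub,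
      AdicCompletion.eval_of, hy, sub_self]
  have h2 : (f - g) x = (f - g) (x - AdicCompletion.of (hIdeal k) M y) := by
    rw [map_sub (f - g), LinearMap.sub_apply f g (AdicCompletion.of (hIdeal k) M y), h, sub_self,
      sub_zero]
  rw [h2]
  have h3 := Submodule.mem_map_of_mem (f := f - g) hx
  rw [Submodule.map_smul''] at h3
  exact Submodule.smul_mono le_rfl le_top h3

/-- The `h`-adically continuous extension of a `K`-linear map `M → Q`, `Q` complete, to the
completion of `M`. -/
def extendFun [IsAdicComplete (hIdeal k) Q] (f : M →ₗ[k⟦X⟧] Q) :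
    AdicCompletion (hIdeal k) M →ₗ[k⟦X⟧] Q :=
  (AdicCompletion.ofLinearEquiv (hIdeal k) Q).symm.toLinearMap ∘ₗ
    (AdicCompletion.map (hIdeal k) f).restrictScalars k⟦X⟧

theorem extendFun_of [IsAdicComplete (hIdeal k) Q] (f : M →ₗ[k⟦X⟧] Q) (m : M) :
    extendFun f (AdicCompletion.of (hIdeal k) M m) = f m := by
  rw [extendFun, LinearMap.comp_apply, LinearMap.restrictScalars_apply, AdicCompletion.map_of]
  exact AdicCompletion.ofLinearEquiv_symm_of _ _

/-- The extension operator `extendFun` is linear in the map. -/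
def extend [IsAdicComplete (hIdeal k) Q] :
    (M →ₗ[k⟦X⟧] Q) →ₗ[k⟦X⟧] (AdicCompletion (hIdeal k) M →ₗ[k⟦X⟧] Q) where
  toFun f := extendFun f
  map_add' f g := completion_hom_ext fun m => by simp [extendFun_of]
  map_smul' c f := completion_hom_ext fun m => by simp [extendFun_of]

@[simp] theorem extend_of [IsAdicComplete (hIdeal k) Q] (f : M →ₗ[k⟦X⟧] Q) (m : M) :
    extend f (AdicCompletion.of (hIdeal k) M m) = f m :=
  extendFun_of f m

/-- The extension of a linear map `M → Hom_K(P, Q)`, `Q` complete, to the completion of `M`. -/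
def extendHom [IsAdicComplete (hIdeal k) Q] (f : M →ₗ[k⟦X⟧] P →ₗ[k⟦X⟧] Q) :
    AdicCompletion (hIdeal k) M →ₗ[k⟦X⟧] P →ₗ[k⟦X⟧] Q :=
  (extend ∘ₗ f.flip).flip

@[simp] theorem extendHom_of [IsAdicComplete (hIdeal k) Q] (f : M →ₗ[k⟦X⟧] P →ₗ[k⟦X⟧] Q) (m : M)
    (p : P) : extendHom f (AdicCompletion.of (hIdeal k) M m) p = f m p := by
  simp [extendHom]

section Ring

variable (R : Type u) [Ring R] [Algebra k⟦X⟧ R]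

/-- The multiplication of the completion of a (noncommutative) `K`-algebra `R`: the continuous
extension of the multiplication of `R`. -/
def completionMul : AdicCompletion (hIdeal k) R →ₗ[k⟦X⟧] AdicCompletion (hIdeal k) R →ₗ[k⟦X⟧]
    AdicCompletion (hIdeal k) R :=
  extendHom (extend ∘ₗ (LinearMap.mul k⟦X⟧ R).compr₂ (AdicCompletion.of (hIdeal k) R))

theorem completionMul_of (a b : R) :
    completionMul (k := k) R (AdicCompletion.of _ R a) (AdicCompletion.of _ R b) =
      AdicCompletion.of _ R (a * b) := by
  simp [completionMul]

theorem completionMul_assoc (x y z : AdicCompletion (hIdeal k) R) :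
    completionMul R (completionMul R x y) z = completionMul R x (completionMul R y z) := by
  have h1 (a b : R) : completionMul (k := k) R (completionMul R (AdicCompletion.of _ R a)
      (AdicCompletion.of _ R b)) = completionMul R (AdicCompletion.of _ R a) ∘ₗ
        completionMul R (AdicCompletion.of _ R b) :=
    completion_hom_ext fun c => by simp [completionMul_of, mul_assoc]
  have h2 (a : R) : (completionMul (k := k) R).flip z ∘ₗ completionMul R (AdicCompletion.of _ R a) =
      completionMul R (AdicCompletion.of _ R a) ∘ₗ (completionMul R).flip z :=
    completion_hom_ext fun b => by simpa using LinearMap.congr_fun (h1 a b) z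
  have h3 : (completionMul (k := k) R).flip z ∘ₗ (completionMul R).flip y =
      (completionMul R).flip (completionMul R y z) :=
    completion_hom_ext fun a => by simpa using LinearMap.congr_fun (h2 a) y
  simpa using LinearMap.congr_fun h3 x

theorem completion_one_mul (x : AdicCompletion (hIdeal k) R) :
    completionMul R (AdicCompletion.of _ R 1) x = x := by
  have : completionMul (k := k) R (AdicCompletion.of _ R 1) = LinearMap.id :=
    completion_hom_ext fun c => by simp [completionMul_of]
  simp [this]

theorem completion_mul_one (x : AdicCompletion (hIdeal k) R) :
    completionMul R x (AdicCompletion.of _ R 1) = x := by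
  have : (completionMul (k := k) R).flip (AdicCompletion.of _ R 1) = LinearMap.id :=
    completion_hom_ext fun c => by simp [completionMul_of]
  simpa using LinearMap.congr_fun this x

/-- The completion of a `K`-algebra as a ring. -/
abbrev completionRing : Ring (AdicCompletion (hIdeal k) R) :=
  { (inferInstance : AddCommGroup (AdicCompletion (hIdeal k) R)) with
    mul := fun x y => completionMul R x y
    one := AdicCompletion.of _ R 1
    mul_assoc := completionMul_assoc R
    one_mul := completion_one_mul R
    mul_one := completion_mul_one R
    left_distrib := fun x y z => map_add (completionMul R x) y z
    right_distrib := fun x y z => by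
      change completionMul R (x + y) z = completionMul R x z + completionMul R y z
      simp
    zero_mul := fun x => by
      change completionMul R 0 x = 0
      simp
    mul_zero := fun x => by
      change completionMul R x 0 = 0
      simp }

end Ring

end Completion

/-! ### Completed tensor products -/

/-- The completed tensor product `M ⊗̂_K N`, the `h`-adic completion of `M ⊗_K N`. -/
abbrev CTensor (k M N : Type u) [Field k] [AddCommGroup M] [Module k⟦X⟧ M] [AddCommGroup N]
    [Module k⟦X⟧ N] : Type u :=
  AdicCompletion (hIdeal k) (M ⊗[k⟦X⟧] N)

namespace CTensor

variable {k M N P Q M' N' : Type u} [Field k] [AddCommGroup M] [Module k⟦X⟧ M] [AddCommGroup N]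
  [Module k⟦X⟧ N] [AddCommGroup P] [Module k⟦X⟧ P] [AddCommGroup Q] [Module k⟦X⟧ Q]
  [AddCommGroup M'] [Module k⟦X⟧ M'] [AddCommGroup N'] [Module k⟦X⟧ N']

/-- The bilinear map `(m, n) ↦ m ⊗ n` to the completed tensor product. -/
def mk : M →ₗ[k⟦X⟧] N →ₗ[k⟦X⟧] CTensor k M N :=
  (TensorProduct.mk k⟦X⟧ M N).compr₂ (AdicCompletion.of (hIdeal k) (M ⊗[k⟦X⟧] N))

/-- The continuous extension to `M ⊗̂ N` of `m ⊗ n ↦ f m n`, for a complete target: if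
`t = lim ∑ mⱼ ⊗ nⱼ` then `lift f t = lim ∑ f mⱼ nⱼ`. -/
def lift [IsAdicComplete (hIdeal k) Q] :
    (M →ₗ[k⟦X⟧] N →ₗ[k⟦X⟧] Q) →ₗ[k⟦X⟧] (CTensor k M N →ₗ[k⟦X⟧] Q) :=
  extend ∘ₗ TensorProduct.uncurry (.id k⟦X⟧) M N Q

@[simp] theorem lift_mk [IsAdicComplete (hIdeal k) Q] (f : M →ₗ[k⟦X⟧] N →ₗ[k⟦X⟧] Q) (m : M)
    (n : N) : lift f (mk m n) = f m n := by
  simp [lift, mk]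

/-- Linear maps out of `M ⊗̂ N` are determined by their values on the tensors `m ⊗ n`. -/
theorem hom_ext [IsHausdorff (hIdeal k) Q] {f g : CTensor k M N →ₗ[k⟦X⟧] Q}
    (h : ∀ m n, f (mk m n) = g (mk m n)) : f = g := by
  refine completion_hom_ext fun t => ?_
  have : f ∘ₗ AdicCompletion.of _ _ = g ∘ₗ AdicCompletion.of _ _ := TensorProduct.ext' h
  exact LinearMap.congr_fun this t

/-- The continuous extension of `m ⊗ n ↦ f m n` with values in `Hom_K(P, Q)`. -/
def liftHom [IsAdicComplete (hIdeal k) Q] (f : M →ₗ[k⟦X⟧] N →ₗ[k⟦X⟧] P →ₗ[k⟦X⟧] Q) :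
    CTensor k M N →ₗ[k⟦X⟧] P →ₗ[k⟦X⟧] Q :=
  extendHom (TensorProduct.lift f)

@[simp] theorem liftHom_mk [IsAdicComplete (hIdeal k) Q]
    (f : M →ₗ[k⟦X⟧] N →ₗ[k⟦X⟧] P →ₗ[k⟦X⟧] Q) (m : M) (n : N) (p : P) :
    liftHom f (mk m n) p = f m n p := by
  simp [liftHom, mk]

/-- The completed tensor product `f ⊗̂ g` of two linear maps. -/
def map (f : M →ₗ[k⟦X⟧] M') (g : N →ₗ[k⟦X⟧] N') : CTensor k M N →ₗ[k⟦X⟧] CTensor k M' N' :=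
  lift (mk.compl₁₂ f g)

/-- The associativity map `(M ⊗̂ N) ⊗̂ P → M ⊗̂ (N ⊗̂ P)`, `(m ⊗ n) ⊗ p ↦ m ⊗ (n ⊗ p)`. -/
def assoc : CTensor k (CTensor k M N) P →ₗ[k⟦X⟧] CTensor k M (CTensor k N P) :=
  lift (liftHom (LinearMap.mk₂ k⟦X⟧
    (fun m n => mk m ∘ₗ mk n)
    (by intros; ext; simp) (by intros; ext; simp) (by intros; ext; simp) (by intros; ext; simp)))

@[simp] theorem map_mk (f : M →ₗ[k⟦X⟧] M') (g : N →ₗ[k⟦X⟧] N') (m : M) (n : N) :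
    map f g (mk m n) = mk (f m) (g n) := by
  simp [map]

@[simp] theorem assoc_mk (m : M) (n : N) (p : P) :
    assoc (mk (mk (k := k) m n) p) = mk m (mk n p) := by
  simp [assoc]

section Algebra

variable {A B : Type u} [Ring A] [Algebra k⟦X⟧ A] [Ring B] [Algebra k⟦X⟧ B]

instance : Ring (CTensor k A B) := completionRing (A ⊗[k⟦X⟧] B)

theorem mul_def (x y : CTensor k A B) : x * y = completionMul (A ⊗[k⟦X⟧] B) x y := rfl

theorem one_def : (1 : CTensor k A B) = mk 1 1 := rfl

instance : Algebra k⟦X⟧ (CTensor k A B) :=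
  Algebra.ofModule
    (fun r x y => by simp only [mul_def, map_smul, LinearMap.smul_apply])
    (fun r x y => by simp only [mul_def, map_smul])

@[simp] theorem mk_mul_mk (a a' : A) (b b' : B) :
    (mk a b * mk a' b' : CTensor k A B) = mk (a * a') (b * b') := by
  simp [mul_def, mk, completionMul_of]

end Algebra

end CTensor

/-! ### The enveloping algebra `A ⊗̂ Aᵒᵖ` -/

section Env

variable (k A : Type u) [Field k] [Ring A] [Algebra k⟦X⟧ A]

/-- The completed enveloping algebra `A ⊗̂_K Aᵒᵖ`. A left module `M` over it carries
`α · m · β = (α ⊗ β) • m`. -/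
abbrev Env : Type u := CTensor k A Aᵐᵒᵖ

theorem env_mul_apply (α β x y : A) :
    (CTensor.mk α (MulOpposite.op β) : Env k A) * (CTensor.mk x (MulOpposite.op y) : Env k A) =
      CTensor.mk (k := k) (α * x) (MulOpposite.op (y * β)) := by
  simp

/-- The action of `A ⊗̂ Aᵒᵖ` on `A`: the continuous extension of `(α ⊗ β) • u = α u β`. -/
def envAct [IsAdicComplete (hIdeal k) A] : Env k A →ₗ[k⟦X⟧] A →ₗ[k⟦X⟧] A :=
  CTensor.liftHom (LinearMap.mk₂ k⟦X⟧
    (fun (α : A) (β : Aᵐᵒᵖ) =>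
      LinearMap.mulLeft k⟦X⟧ α ∘ₗ LinearMap.mulRight k⟦X⟧ (MulOpposite.unop β))
    (by intros; ext; simp [add_mul]) (by intros; ext; simp)
    (by intros; ext; simp [mul_add]) (by intros; ext; simp))

@[simp] theorem envAct_mk [IsAdicComplete (hIdeal k) A] (α : A) (β : Aᵐᵒᵖ) (u : A) :
    envAct k A (CTensor.mk α β) u = α * (u * β.unop) := by
  simp [envAct]

theorem envAct_mul [IsAdicComplete (hIdeal k) A] (z w : Env k A) (u : A) :
    envAct k A (z * w) u = envAct k A z (envAct k A w u) := by
  have h1 (α : A) (β : Aᵐᵒᵖ) : (envAct k A).flip u ∘ₗ completionMul _ (CTensor.mk α β) =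
      envAct k A (CTensor.mk α β) ∘ₗ (envAct k A).flip u :=
    CTensor.hom_ext fun a b => by
      have := congrArg (fun t => envAct k A t u) (CTensor.mk_mul_mk (k := k) α a β b)
      rw [CTensor.mul_def] at this
      simpa [mul_assoc] using this
  have h2 : (envAct k A).flip u ∘ₗ (completionMul _).flip w =
      (envAct k A).flip (envAct k A w u) :=
    CTensor.hom_ext fun α β => by simpa using LinearMap.congr_fun (h1 α β) w
  exact LinearMap.congr_fun h2 z

/-- `A` as a left module over `A ⊗̂ Aᵒᵖ`. -/
instance [IsAdicComplete (hIdeal k) A] : Module (Env k A) A where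
  smul z u := envAct k A z u
  one_smul u := by
    change envAct k A 1 u = u
    simp [CTensor.one_def]
  mul_smul z w u := envAct_mul k A z w u
  smul_zero z := map_zero (envAct k A z)
  smul_add z u v := map_add (envAct k A z) u v
  add_smul z w u := by
    change envAct k A (z + w) u = envAct k A z u + envAct k A w u
    simp
  zero_smul u := by
    change envAct k A 0 u = 0
    simp

theorem env_smul_def [IsAdicComplete (hIdeal k) A] (α β u : A) :
    (CTensor.mk α (MulOpposite.op β) : Env k A) • u = α * u * β := by
  change envAct k A _ u = _
  simp [mul_assoc]

/-- The exchange map of `A ⊗̂ Aᵒᵖ`: the continuous extension of `α ⊗ β ↦ β ⊗ α`. -/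
def envFlip : Env k A →ₗ[k⟦X⟧] Env k A :=
  CTensor.lift ((CTensor.mk (k := k)).compl₁₂ (MulOpposite.opLinearEquiv k⟦X⟧).symm.toLinearMap
    (MulOpposite.opLinearEquiv k⟦X⟧).toLinearMap).flip

@[simp] theorem envFlip_mk (α : A) (β : Aᵐᵒᵖ) :
    envFlip k A (CTensor.mk α β) = CTensor.mk (k := k) β.unop (MulOpposite.op α) := by
  simp [envFlip]

theorem envFlip_mul (z w : Env k A) : envFlip k A (z * w) = envFlip k A w * envFlip k A z := by
  have h1 (α : A) (β : Aᵐᵒᵖ) : envFlip k A ∘ₗ completionMul _ (CTensor.mk α β) =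
      (completionMul _).flip (envFlip k A (CTensor.mk α β)) ∘ₗ envFlip k A :=
    CTensor.hom_ext fun a b => by
      simp only [LinearMap.comp_apply, LinearMap.flip_apply, ← CTensor.mul_def]
      simp
  have h2 : envFlip k A ∘ₗ (completionMul _).flip w =
      completionMul _ (envFlip k A w) ∘ₗ envFlip k A :=
    CTensor.hom_ext fun α β => by simpa using LinearMap.congr_fun (h1 α β) w
  exact LinearMap.congr_fun h2 z

/-- The exchange map as an isomorphism onto the opposite algebra (only the homomorphism is
needed). It turns right modules over `A ⊗̂ Aᵒᵖ` into left modules. -/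
def envFlipHom : Env k A →+* (Env k A)ᵐᵒᵖ where
  toFun z := MulOpposite.op (envFlip k A z)
  map_one' := by
    rw [CTensor.one_def, envFlip_mk, MulOpposite.unop_one, MulOpposite.op_one]
    rfl
  map_mul' z w := by simp [envFlip_mul]
  map_zero' := by simp
  map_add' z w := by simp

end Env

/-! ### `Ext` groups with values in the regular module -/

section ExtReg

variable (R : Type u) [Ring R] (M : ModuleCat.{u} R) (n : ℕ)

/-- `Ext^n_R(M, R)`, for a left `R`-module `M`. -/
def ExtReg : Type u := Abelian.Ext M (ModuleCat.of R R) n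

instance : AddCommGroup (ExtReg R M n) :=
  inferInstanceAs (AddCommGroup (Abelian.Ext M (ModuleCat.of R R) n))

/-- Right multiplication by `a`, an endomorphism of the left module `R`. -/
def rightMul (a : R) : ModuleCat.of R R ⟶ ModuleCat.of R R :=
  ModuleCat.ofHom (LinearMap.toSpanSingleton R R a)

/-- The right `R`-module structure of `Ext^n_R(M, R)`, by functoriality with respect to the right
multiplications of `R`. -/
abbrev extModule : Module Rᵐᵒᵖ (Abelian.Ext M (ModuleCat.of R R) n) where
  smul a x := x.comp (Abelian.Ext.mk₀ (rightMul R a.unop)) (add_zero n)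
  one_smul x := by
    have : rightMul R 1 = 𝟙 _ := by
      ext
      simp [rightMul]
    change x.comp (Abelian.Ext.mk₀ (rightMul R 1)) (add_zero n) = x
    rw [this, Abelian.Ext.comp_mk₀_id]
  mul_smul a b x := by
    have : rightMul R (a * b).unop = rightMul R b.unop ≫ rightMul R a.unop := by
      ext
      simp [rightMul]
    change x.comp (Abelian.Ext.mk₀ (rightMul R (a * b).unop)) (add_zero n) = _
    rw [this, ← Abelian.Ext.mk₀_comp_mk₀]
    exact (Abelian.Ext.comp_assoc_of_second_deg_zero _ _ _ _).symm
  smul_zero a := Abelian.Ext.zero_comp _ _ _ _ _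
  smul_add a x y := Abelian.Ext.add_comp _ _ _ _
  add_smul a b x := by
    have : rightMul R (a + b).unop = rightMul R a.unop + rightMul R b.unop := by
      ext
      simp [rightMul]
    change x.comp (Abelian.Ext.mk₀ (rightMul R (a + b).unop)) (add_zero n) = _
    rw [this, Abelian.Ext.mk₀_add]
    exact Abelian.Ext.comp_add _ _ _ _
  zero_smul x := by
    have : rightMul R 0 = 0 := by
      ext
      simp [rightMul]
    change x.comp (Abelian.Ext.mk₀ (rightMul R 0)) (add_zero n) = _
    rw [this, Abelian.Ext.mk₀_zero]
    exact Abelian.Ext.comp_zero _ _ _ _ _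

instance : Module Rᵐᵒᵖ (ExtReg R M n) := extModule R M n

/-- If `R` is an algebra over a commutative ring `S`, then `Ext^n_R(M, R)` is an `S`-module. -/
instance (S : Type u) [CommRing S] [Algebra S R] : Module S (ExtReg R M n) :=
  Module.compHom _ (algebraMap S Rᵐᵒᵖ)

end ExtReg

/-- The ring `S` as a left `R`-module through a ring homomorphism `ε : R → S`. -/
abbrev moduleOfChar {R S : Type u} [Ring R] [Ring S] (ε : R →+* S) : ModuleCat.{u} R :=
  (ModuleCat.restrictScalars ε).obj (ModuleCat.of S S)

/-! ### Deformations and topological Hopf algebras -/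

/-- An isomorphism of `k`-algebras `A / hA ≃ A₀`, given as the projection `A → A₀`. -/
structure Reduction (k A A₀ : Type u) [Field k] [Ring A] [Algebra k⟦X⟧ A] [Ring A₀]
    [Algebra k A₀] where
  proj : A →+* A₀
  proj_algebraMap : ∀ c : k, proj (algebraMap k⟦X⟧ A (PowerSeries.C c)) = algebraMap k A₀ c
  surjective : Function.Surjective proj
  proj_eq_zero_iff : ∀ a : A, proj a = 0 ↔ ∃ b : A, a = (PowerSeries.X : k⟦X⟧) • b

/-- A topological Hopf algebra structure on a complete `k⟦h⟧`-algebra `A`. Linear maps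
over `k⟦h⟧` are automatically continuous for the `h`-adic topologies. -/
structure TopHopf (k A : Type u) [Field k] [Ring A] [Algebra k⟦X⟧ A]
    [IsAdicComplete (hIdeal k) A] where
  comul : A →ₐ[k⟦X⟧] CTensor k A A
  counit : A →ₐ[k⟦X⟧] k⟦X⟧
  antipode : A →ₗ[k⟦X⟧] A
  coassoc : ∀ a, CTensor.assoc (CTensor.map comul.toLinearMap LinearMap.id (comul a)) =
    CTensor.map LinearMap.id comul.toLinearMap (comul a)
  counit_comul : ∀ a, CTensor.lift
    (LinearMap.lsmul k⟦X⟧ A ∘ₗ counit.toLinearMap) (comul a) = a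
  comul_counit : ∀ a, CTensor.lift
    (LinearMap.lsmul k⟦X⟧ A ∘ₗ counit.toLinearMap).flip (comul a) = a
  antipode_mul : ∀ a, CTensor.lift (LinearMap.mul k⟦X⟧ A ∘ₗ antipode) (comul a) =
    algebraMap k⟦X⟧ A (counit a)
  mul_antipode : ∀ a, CTensor.lift ((LinearMap.mul k⟦X⟧ A).compl₂ antipode) (comul a) =
    algebraMap k⟦X⟧ A (counit a)

namespace TopHopf

variable {k A : Type u} [Field k] [Ring A] [Algebra k⟦X⟧ A] [IsAdicComplete (hIdeal k) A]
  (H : TopHopf k A)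

/-- `Ω_A^n = Ext^n_A(K, A)`, where `A` acts on `K = k⟦h⟧` through the counit; a right
`A`-module by right multiplication. -/
abbrev Omega (n : ℕ) : Type u := ExtReg A (moduleOfChar (H.counit : A →+* k⟦X⟧)) n

/-- The inverse of a bijective antipode. -/
def antipodeInv (hS : Function.Bijective H.antipode) : A →ₗ[k⟦X⟧] A :=
  (LinearEquiv.ofBijective H.antipode hS).symm.toLinearMap

/-- `β ↦ ∑ θ(β'ᵢ) S(β''ᵢ)` where `Δ(β) = ∑ β'ᵢ ⊗ β''ᵢ` in the topological sense. -/
def twist (θ : A →ₐ[k⟦X⟧] k⟦X⟧) : A →ₗ[k⟦X⟧] A :=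
  CTensor.lift ((LinearMap.lsmul k⟦X⟧ A).compl₁₂ θ.toLinearMap H.antipode) ∘ₗ
    H.comul.toLinearMap

/-- The action of `A ⊗̂ Aᵒᵖ` on `A` which is the continuous extension of
`α · x · β = ∑ θ(β'ᵢ) S(β''ᵢ) x S⁻¹(α)`. -/
def twistedAct (hS : Function.Bijective H.antipode) (θ : A →ₐ[k⟦X⟧] k⟦X⟧) :
    Env k A →ₗ[k⟦X⟧] A →ₗ[k⟦X⟧] A :=
  CTensor.liftHom (LinearMap.mk₂ k⟦X⟧
    (fun (α : A) (β : Aᵐᵒᵖ) =>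
      LinearMap.mulLeft k⟦X⟧ (H.twist θ β.unop) ∘ₗ
        LinearMap.mulRight k⟦X⟧ (H.antipodeInv hS α))
    (by intros; ext; simp [mul_add]) (by intros; ext; simp)
    (by intros; ext; simp [add_mul]) (by intros; ext; simp))

@[simp] theorem twistedAct_mk (hS : Function.Bijective H.antipode) (θ : A →ₐ[k⟦X⟧] k⟦X⟧)
    (α β x : A) : H.twistedAct hS θ (CTensor.mk α (MulOpposite.op β)) x =
      H.twist θ β * (x * H.antipodeInv hS α) := by
  simp [twistedAct]

/-- The action of `A ⊗̂ Aᵒᵖ` on `Ω ⊗_K A` with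
`α · (ω ⊗ x) · β = ∑ θ(β'ᵢ) ω ⊗ S(β''ᵢ) x S⁻¹(α)`; the scalars `θ(β'ᵢ) ∈ K` are moved to the
second tensor factor. -/
def omegaAct (hS : Function.Bijective H.antipode) (θ : A →ₐ[k⟦X⟧] k⟦X⟧) (n : ℕ) (z : Env k A) :
    H.Omega n ⊗[k⟦X⟧] A →ₗ[k⟦X⟧] H.Omega n ⊗[k⟦X⟧] A :=
  LinearMap.lTensor (H.Omega n) (H.twistedAct hS θ z)

end TopHopf

/-! ### Hochschild cohomology -/

section Hochschild

variable (k A : Type u) [Field k] [Ring A] [Algebra k⟦X⟧ A] [IsAdicComplete (hIdeal k) A]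

/-- `HH^n_A(M) = Ext^n_{A ⊗̂ Aᵒᵖ}(A, M)` for a left `A ⊗̂ Aᵒᵖ`-module `M`. -/
abbrev HochschildCohomology (M : ModuleCat.{u} (Env k A)) (n : ℕ) : Type u :=
  Abelian.Ext (ModuleCat.of (Env k A) A) M n

/-- `A ⊗̂ A` with the outer bimodule structure `α · (x ⊗ y) · β = αx ⊗ yβ`: the left regular
module of `A ⊗̂ Aᵒᵖ`, see `env_mul_apply`. -/
abbrev Outer : ModuleCat.{u} (Env k A) := ModuleCat.of (Env k A) (Env k A)

/-- `HH^n_A(A ⊗̂ A)`, the group `HochschildCohomology k A (Outer k A) n`, as an `Ext` group with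
values in the regular module. -/
abbrev HHOuter (n : ℕ) : Type u := ExtReg (Env k A) (ModuleCat.of (Env k A) A) n

/-- `HH^n_A(A ⊗̂ A)` is a left `A ⊗̂ Aᵒᵖ`-module through the inner bimodule structure
`α · (x ⊗ y) · β = xβ ⊗ αy` of `A ⊗̂ A`, which commutes with the outer one: `z` acts by
functoriality of `Ext` through right multiplication by `envFlip z`. -/
instance (n : ℕ) : Module (Env k A) (HHOuter k A n) :=
  Module.compHom _ (envFlipHom k A)

end Hochschild

end

end QDuality

/-! The argument has three steps: transfer the hypothesis on `Ext` from `A₀` to `A` by `h`-adic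
approximation, split the resulting complexes over `K = k⟦h⟧`, and carry them to the enveloping
algebra by a Hopf-theoretic change of variables.

Since `A₀` is noetherian and `A` is complete without torsion, `K` has a resolution over `A` by
finite free modules (`Reduction.exists_freeResolution`), and its reduction modulo `h` resolves `k`
over `A₀`. The reduced dual complex therefore has cohomology only in degree `d`, a line. Successive
approximation lifts this: the dual complex over `A` is exact outside degree `d`, and in degree `d`
its cohomology is free over `K` on the class of a cocycle `ω`. Right multiplication on that class is
the character `θ`.

Completed tensor products need not preserve exactness, but they preserve identities between maps.
Complete torsion-free modules are projective relative to surjections from complete modules onto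
separated ones (`exists_lift_of_surjective`), so the complexes in question have contracting
homotopies over `K`; in degree `d` of the dual complex the homotopy has an additional term that
involves `ω` and a linear form `p` (`IsDualityComplex.exists_generator`).

The homomorphism `δ(a) = ∑ a' ⊗ S(a'')` makes `A ⊗̂ Aᵒᵖ` topologically free over `A` on either side,
by `x ⊗ y ↦ (1 ⊗ y) δ(x)` and `x ⊗ y ↦ δ(x) (1 ⊗ y)`. The first isomorphism shows that applying `δ`
to the matrices of the resolution of `K` yields a resolution of `A` as a bimodule
(`TopHopf.isFreeResolution_env`). The second identifies its dual with the dual complex over `A`,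
tensored with `Aᵒᵖ`. So `HH^i(A ⊗̂ A)` vanishes for `i ≠ d`, and `HH^d(A ⊗̂ A)` consists of the
classes of `δ(ω) (1 ⊗ y)`. The inner action is then computed from `β ⊗ 1 = ∑ δ(β') (1 ⊗ S²(β''))`
(`IsGenerator.envForm_mul_envFlip`). -/

open CategoryTheory

namespace QDuality

open scoped TensorProduct PowerSeries

noncomputable section

/-! ### Complete torsion-free modules over `k⟦h⟧` -/

section CompleteModules

variable {k : Type u} [Field k]

/-- A `k⟦h⟧`-module without `h`-torsion. -/
class HTorsionFree (k M : Type u) [Field k] [AddCommGroup M] [Module k⟦X⟧ M] : Prop where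
  eq_zero : ∀ m : M, (PowerSeries.X : k⟦X⟧) • m = 0 → m = 0

variable {M N L : Type u} [AddCommGroup M] [Module k⟦X⟧ M] [AddCommGroup N] [Module k⟦X⟧ N]
  [AddCommGroup L] [Module k⟦X⟧ L]

theorem HTorsionFree.cancel [HTorsionFree k M] {m m' : M}
    (h : (PowerSeries.X : k⟦X⟧) • m = (PowerSeries.X : k⟦X⟧) • m') : m = m' :=
  sub_eq_zero.mp (HTorsionFree.eq_zero (k := k) _ (by rw [smul_sub, h, sub_self]))

theorem HTorsionFree.of_injective [HTorsionFree k N] (f : M →ₗ[k⟦X⟧] N)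
    (hf : Function.Injective f) : HTorsionFree k M :=
  ⟨fun m h => hf (by
    rw [map_zero]
    exact HTorsionFree.eq_zero (k := k) _ (by rw [← map_smul, h, map_zero]))⟩

theorem mem_pow_smul_top_iff (n : ℕ) (x : M) :
    x ∈ (hIdeal k ^ n • ⊤ : Submodule k⟦X⟧ M) ↔ ∃ y, x = (PowerSeries.X ^ n : k⟦X⟧) • y := by
  rw [hIdeal, Ideal.span_singleton_pow, Submodule.ideal_span_singleton_smul,
    Submodule.mem_smul_pointwise_iff_exists]
  simp [eq_comm]

theorem isHausdorff_iff_forall :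
    IsHausdorff (hIdeal k) M ↔
      ∀ x : M, (∀ n : ℕ, ∃ y, x = (PowerSeries.X ^ n : k⟦X⟧) • y) → x = 0 := by
  simp only [isHausdorff_iff, SModEq.zero, mem_pow_smul_top_iff]

theorem IsHausdorff.eq_zero_of_forall [IsHausdorff (hIdeal k) M] (x : M)
    (h : ∀ n : ℕ, ∃ y, x = (PowerSeries.X ^ n : k⟦X⟧) • y) : x = 0 :=
  isHausdorff_iff_forall.mp ‹_› x h

theorem IsHausdorff.of_injective [IsHausdorff (hIdeal k) N] (f : M →ₗ[k⟦X⟧] N)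
    (hf : Function.Injective f) : IsHausdorff (hIdeal k) M := by
  rw [isHausdorff_iff_forall]
  intro x hx
  refine hf ?_
  rw [map_zero]
  refine IsHausdorff.eq_zero_of_forall (k := k) _ fun n => ?_
  obtain ⟨y, rfl⟩ := hx n
  exact ⟨f y, by rw [map_smul]⟩

/-- Completion preserves surjections, so a point of the completion of `N` comes from the completion
of `M`, hence from `M` itself. -/
theorem IsPrecomplete.of_surjective [IsPrecomplete (hIdeal k) M] (f : M →ₗ[k⟦X⟧] N)
    (hf : Function.Surjective f) : IsPrecomplete (hIdeal k) N := by
  rw [← AdicCompletion.of_surjective_iff]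
  intro y
  obtain ⟨x, rfl⟩ := AdicCompletion.map_surjective (hIdeal k) hf y
  obtain ⟨z, rfl⟩ := AdicCompletion.of_surjective (hIdeal k) M x
  exact ⟨f z, by rw [AdicCompletion.map_of]⟩

/-- Successive approximation: if every element of `P` is a value of `f` up to `h` times an element
of `P`, then it is a value of `f`. -/
theorem exists_eq_of_approx [IsPrecomplete (hIdeal k) M] [IsHausdorff (hIdeal k) N]
    (f : M →ₗ[k⟦X⟧] N) (P : N → Prop)
    (h : ∀ y, P y → ∃ x z, P z ∧ y = f x + (PowerSeries.X : k⟦X⟧) • z) (y : N) (hy : P y) :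
    ∃ x, f x = y := by
  choose φ ψ hψ hφ using h
  -- `z n` is the remainder after `n` steps, `a n` the next digit and `s n` the partial sum of the
  -- digits. The predicate `P` is what allows the procedure to be repeated on the remainder.
  let z : ℕ → {y // P y} := fun n => Nat.rec ⟨y, hy⟩ (fun _ w => ⟨ψ w.1 w.2, hψ w.1 w.2⟩) n
  let a : ℕ → M := fun n => φ (z n).1 (z n).2
  have hz : ∀ n, (z n).1 = f (a n) + (PowerSeries.X : k⟦X⟧) • (z (n + 1)).1 :=
    fun n => hφ (z n).1 (z n).2
  let s : ℕ → M := fun n => ∑ i ∈ Finset.range n, (PowerSeries.X ^ i : k⟦X⟧) • a i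
  have hs : ∀ n, y = f (s n) + (PowerSeries.X ^ n : k⟦X⟧) • (z n).1 := by
    intro n
    induction n with
    | zero => simp [s, z]
    | succ n ih =>
      rw [ih, hz n]
      simp only [s, Finset.sum_range_succ, map_add, map_smul, smul_add, ← mul_smul, ← pow_succ]
      abel
  have hc : ∀ m n, ∃ w, s (m + n) - s m = (PowerSeries.X ^ m : k⟦X⟧) • w := by
    intro m n
    refine ⟨∑ i ∈ Finset.range n, (PowerSeries.X ^ i : k⟦X⟧) • a (m + i), ?_⟩
    simp only [s, Finset.sum_range_add, add_sub_cancel_left, Finset.smul_sum, ← mul_smul, pow_add]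
  obtain ⟨x, hx⟩ := IsPrecomplete.prec (I := hIdeal k) ‹_› (f := s) (fun {m n} hmn => by
    obtain ⟨w, hw⟩ := hc m (n - m)
    rw [Nat.add_sub_cancel' hmn] at hw
    refine SModEq.symm ?_
    rw [SModEq.sub_mem, mem_pow_smul_top_iff]
    exact ⟨w, hw⟩)
  refine ⟨x, ?_⟩
  rw [← sub_eq_zero]
  refine IsHausdorff.eq_zero_of_forall (k := k) _ fun n => ?_
  have := hx n
  rw [SModEq.sub_mem, mem_pow_smul_top_iff] at this
  obtain ⟨w, hw⟩ := this
  -- Two errors are divisible by `hⁿ`: the remainder `hⁿ z n`, and the difference `s n - x = hⁿ w`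
  -- between the partial sum and its limit.
  refine ⟨-(f w + (z n).1), ?_⟩
  rw [hs n, smul_neg, smul_add, ← map_smul, ← hw, map_sub]
  abel

theorem surjective_of_approx [IsPrecomplete (hIdeal k) M] [IsHausdorff (hIdeal k) N]
    (f : M →ₗ[k⟦X⟧] N) (h : ∀ y, ∃ x z, y = f x + (PowerSeries.X : k⟦X⟧) • z) :
    Function.Surjective f := fun y =>
  exists_eq_of_approx f (fun _ => True)
    (fun y _ => (h y).imp fun _ ⟨z, hz⟩ => ⟨z, trivial, hz⟩) y trivial

/-- An element of the kernel is divisible by `h`, and without torsion in `N` the quotient is again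
in the kernel. Iteration makes it divisible by every `hⁿ`. -/
theorem injective_of_approx [IsHausdorff (hIdeal k) M] [HTorsionFree k N] (f : M →ₗ[k⟦X⟧] N)
    (h : ∀ x z, f x = (PowerSeries.X : k⟦X⟧) • z → ∃ x', x = (PowerSeries.X : k⟦X⟧) • x') :
    Function.Injective f := by
  rw [injective_iff_map_eq_zero]
  intro x hx
  refine IsHausdorff.eq_zero_of_forall (k := k) _ fun n => ?_
  suffices ∃ y, x = (PowerSeries.X ^ n : k⟦X⟧) • y ∧ f y = 0 from this.imp fun _ h => h.1
  induction n with
  | zero => exact ⟨x, by simp, hx⟩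
  | succ n ih =>
    obtain ⟨y, rfl, hy⟩ := ih
    obtain ⟨y', rfl⟩ := h y 0 (by rw [hy, smul_zero])
    refine ⟨y', by rw [pow_succ, mul_smul], ?_⟩
    rw [map_smul] at hy
    exact HTorsionFree.eq_zero _ hy

instance : HTorsionFree k k⟦X⟧ :=
  ⟨fun m h => by simpa [PowerSeries.X_ne_zero] using h⟩

instance {V : Type u} [AddCommGroup V] [Module k V] : HTorsionFree k (FormalSeries V) :=
  ⟨fun v h => by
    ext n
    have h' := congrArg (fun w => FormalSeries.coeff w (n + 1)) h
    simp only [FormalSeries.coeff_smul, FormalSeries.coeff_zero] at h'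
    rw [Finset.sum_eq_single (1, n)] at h'
    · simpa [FormalSeries.coeff_zero] using h'
    · rintro ⟨a, b⟩ hab hne
      have : a ≠ 1 := by
        rintro rfl
        simp at hab
        exact hne (by rw [Prod.mk.injEq]; omega)
      simp [PowerSeries.coeff_X, this]
    · intro hn
      exact absurd (by simp; omega) hn⟩

theorem IsTopologicallyFree.hTorsionFree [IsTopologicallyFree k M] : HTorsionFree k M := by
  obtain ⟨V, _, _, ⟨e⟩⟩ := IsTopologicallyFree.exists_equiv (k := k) (M := M)
  exact HTorsionFree.of_injective e.toLinearMap e.injective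

instance {ι : Type} [HTorsionFree k M] : HTorsionFree k (ι → M) :=
  ⟨fun m h => funext fun i => HTorsionFree.eq_zero (k := k) (m i) (congrFun h i)⟩

instance {ι : Type} [IsAdicComplete (hIdeal k) M] : IsAdicComplete (hIdeal k) (ι → M) where
  toIsHausdorff := by
    rw [isHausdorff_iff_forall]
    intro x hx
    funext i
    refine IsHausdorff.eq_zero_of_forall (k := k) _ fun n => ?_
    obtain ⟨y, rfl⟩ := hx n
    exact ⟨y i, rfl⟩
  prec' f hf := by
    have (i : ι) : ∃ x : M, ∀ n, f n i ≡ x [SMOD (hIdeal k ^ n • ⊤ : Submodule k⟦X⟧ M)] := by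
      refine IsPrecomplete.prec (I := hIdeal k) inferInstance (f := fun n => f n i)
        fun {m n} hmn => ?_
      have := hf hmn
      rw [SModEq.sub_mem, mem_pow_smul_top_iff] at this ⊢
      obtain ⟨y, hy⟩ := this
      exact ⟨y i, congrFun hy i⟩
    choose x hx using this
    refine ⟨x, fun n => ?_⟩
    simp only [SModEq.sub_mem, mem_pow_smul_top_iff] at hx ⊢
    choose y hy using fun i => hx i n
    exact ⟨y, funext hy⟩

instance : (hIdeal k).IsMaximal :=
  by rw [hIdeal, ← PowerSeries.maximalIdeal_eq_span_X]; infer_instance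

/-- A complete torsion-free module is projective with respect to surjections of a complete module
onto a separated one. -/
theorem exists_lift_of_surjective [IsAdicComplete (hIdeal k) M] [HTorsionFree k M]
    [IsAdicComplete (hIdeal k) N] [IsHausdorff (hIdeal k) L] (f : N →ₗ[k⟦X⟧] L)
    (hf : Function.Surjective f) (g : M →ₗ[k⟦X⟧] L) : ∃ t : M →ₗ[k⟦X⟧] N, f ∘ₗ t = g := by
  -- Lifts `c` of a basis of `M / hM` identify `M` with the completion of a free module. A map out
  -- of such a completion into `N` is given by arbitrary images of the basis, here preimages `a` of
  -- the `g (c j)`.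
  let _ : Field (k⟦X⟧ ⧸ hIdeal k) := Ideal.Quotient.field _
  let V := M ⧸ (hIdeal k • ⊤ : Submodule k⟦X⟧ M)
  let b := Module.Basis.ofVectorSpace (k⟦X⟧ ⧸ hIdeal k) V
  let J := Module.Basis.ofVectorSpaceIndex (k⟦X⟧ ⧸ hIdeal k) V
  choose c hc using fun j : J => Submodule.mkQ_surjective (hIdeal k • ⊤ : Submodule k⟦X⟧ M) (b j)
  choose a ha using fun j : J => hf (g (c j))
  have hmk (y : J →₀ k⟦X⟧) : Submodule.mkQ (hIdeal k • ⊤ : Submodule k⟦X⟧ M)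
      (Finsupp.linearCombination k⟦X⟧ c y) = Finsupp.linearCombination (k⟦X⟧ ⧸ hIdeal k) b
        (y.mapRange (Ideal.Quotient.mk (hIdeal k)) (map_zero _)) := by
    rw [Finsupp.linearCombination_apply, Finsupp.linearCombination_apply,
      Finsupp.sum_mapRange_index (by simp), Finsupp.sum, map_sum]
    refine Finset.sum_congr rfl fun j _ => ?_
    rw [map_smul, hc]
    rfl
  have hdvd (x : M) : Submodule.mkQ (hIdeal k • ⊤ : Submodule k⟦X⟧ M) x = 0 ↔
      ∃ y, x = (PowerSeries.X : k⟦X⟧) • y := by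
    rw [← LinearMap.mem_ker, Submodule.ker_mkQ, ← pow_one (hIdeal k), mem_pow_smul_top_iff, pow_one]
  let φ : AdicCompletion (hIdeal k) (J →₀ k⟦X⟧) →ₗ[k⟦X⟧] M :=
    extend (Finsupp.linearCombination k⟦X⟧ c)
  have hφ (y : J →₀ k⟦X⟧) : φ (AdicCompletion.of _ _ y) = Finsupp.linearCombination k⟦X⟧ c y :=
    extend_of _ _
  have hsurj : Function.Surjective φ := by
    refine surjective_of_approx φ fun m => ?_
    let v := b.repr (Submodule.mkQ (hIdeal k • ⊤ : Submodule k⟦X⟧ M) m)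
    obtain ⟨y, hy⟩ := Finsupp.mapRange_surjective (Ideal.Quotient.mk (hIdeal k)) (map_zero _)
      Ideal.Quotient.mk_surjective v
    have : Submodule.mkQ (hIdeal k • ⊤ : Submodule k⟦X⟧ M)
        (m - Finsupp.linearCombination k⟦X⟧ c y) = 0 := by
      rw [map_sub, hmk, hy, b.linearCombination_repr, sub_self]
    obtain ⟨z, hz⟩ := (hdvd _).mp this
    exact ⟨AdicCompletion.of _ _ y, z, by rw [hφ, ← hz]; abel⟩
  have hinj : Function.Injective φ := by
    refine injective_of_approx φ fun x z hx => ?_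
    obtain ⟨y, hy⟩ := Submodule.mkQ_surjective _ (AdicCompletion.eval (hIdeal k) _ 1 x)
    have hxy : x - AdicCompletion.of (hIdeal k) _ y ∈ (hIdeal k ^ 1 • ⊤ : Submodule k⟦X⟧ _) := by
      rw [AdicCompletion.pow_smul_top_eq_ker_eval hIdeal_fg, LinearMap.mem_ker, map_sub,
        AdicCompletion.eval_of, hy, sub_self]
    rw [mem_pow_smul_top_iff, pow_one] at hxy
    obtain ⟨w, hw⟩ := hxy
    have h0 : Submodule.mkQ (hIdeal k • ⊤ : Submodule k⟦X⟧ M)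
        (Finsupp.linearCombination k⟦X⟧ c y) = 0 := by
      rw [hdvd]
      refine ⟨z - φ w, ?_⟩
      rw [smul_sub, ← hx, ← map_smul, ← hw, map_sub, hφ]
      abel
    rw [hmk] at h0
    -- The relation holds in `M / hM`, so every coefficient of `y` is divisible by `h`.
    have h1 := linearIndependent_iff.mp b.linearIndependent _ h0
    have h2 (j : J) : ∃ r, y j = PowerSeries.X * r := by
      have := DFunLike.congr_fun h1 j
      rw [Finsupp.mapRange_apply, Finsupp.zero_apply, Ideal.Quotient.eq_zero_iff_mem,
        Ideal.mem_span_singleton] at this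
      exact this
    choose r hr using h2
    have hr0 (j : J) : y j ≠ 0 ↔ r j ≠ 0 := by
      rw [hr]
      simp [PowerSeries.X_ne_zero]
    let y' : J →₀ k⟦X⟧ := Finsupp.onFinset y.support r (fun j hj => by simpa [hr0] using hj)
    have hy' : y = (PowerSeries.X : k⟦X⟧) • y' := by
      ext1 j
      simp [y', hr j]
    refine ⟨w + AdicCompletion.of _ _ y', ?_⟩
    rw [smul_add, ← hw, ← map_smul, ← hy']
    abel
  let e := LinearEquiv.ofBijective φ ⟨hinj, hsurj⟩
  let t : AdicCompletion (hIdeal k) (J →₀ k⟦X⟧) →ₗ[k⟦X⟧] N :=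
    extend (Finsupp.linearCombination k⟦X⟧ a)
  have ht : f ∘ₗ t = g ∘ₗ φ := completion_hom_ext fun y => by
    rw [LinearMap.comp_apply, LinearMap.comp_apply, hφ, extend_of,
      Finsupp.apply_linearCombination, Finsupp.apply_linearCombination]
    congr 2
    funext j
    exact ha j
  refine ⟨t ∘ₗ e.symm.toLinearMap, ?_⟩
  rw [← LinearMap.comp_assoc, ht]
  ext m
  exact congrArg g (e.apply_symm_apply m)

/-- A linear map between complete torsion-free modules whose image is the kernel of a map to a
separated torsion-free module has a generalized inverse. -/
theorem exists_generalized_inverse [IsAdicComplete (hIdeal k) M] [IsAdicComplete (hIdeal k) N]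
    [HTorsionFree k N] [IsHausdorff (hIdeal k) L] [HTorsionFree k L]
    (f : M →ₗ[k⟦X⟧] N) (q : N →ₗ[k⟦X⟧] L) (h : LinearMap.range f = LinearMap.ker q) :
    ∃ t : N →ₗ[k⟦X⟧] M, f ∘ₗ t ∘ₗ f = f := by
  -- `Q` embeds in `L`, so it is separated and torsion-free; as a quotient of `N` it is precomplete.
  -- Hence `N → Q` has a section and the image of `f` is a direct summand of `N`.
  let Q := N ⧸ LinearMap.ker q
  let j : Q →ₗ[k⟦X⟧] L := (LinearMap.ker q).liftQ q le_rfl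
  have hj : Function.Injective j := by
    rw [← LinearMap.ker_eq_bot, Submodule.ker_liftQ_eq_bot _ _ _ le_rfl]
  have : HTorsionFree k Q := HTorsionFree.of_injective j hj
  have : IsHausdorff (hIdeal k) Q := IsHausdorff.of_injective j hj
  have : IsPrecomplete (hIdeal k) Q :=
    IsPrecomplete.of_surjective _ (Submodule.mkQ_surjective (LinearMap.ker q))
  have : IsAdicComplete (hIdeal k) Q := ⟨⟩
  obtain ⟨s, hs⟩ := exists_lift_of_surjective _ (Submodule.mkQ_surjective (LinearMap.ker q))
    (LinearMap.id : Q →ₗ[k⟦X⟧] Q)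
  -- The projection of `N` onto the image of `f` along the section `s`; a lift of it through `f` is
  -- the generalized inverse.
  let p : N →ₗ[k⟦X⟧] LinearMap.range f :=
    (LinearMap.id - s ∘ₗ (LinearMap.ker q).mkQ).codRestrict _ fun x => by
      have h1 : (LinearMap.ker q).mkQ (s ((LinearMap.ker q).mkQ x)) = (LinearMap.ker q).mkQ x :=
        LinearMap.congr_fun hs _
      rw [h]
      exact (Submodule.Quotient.eq _).mp h1.symm
  have : IsHausdorff (hIdeal k) (LinearMap.range f) :=
    IsHausdorff.of_injective (LinearMap.range f).subtype Subtype.val_injective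
  obtain ⟨t, ht⟩ := exists_lift_of_surjective f.rangeRestrict f.surjective_rangeRestrict p
  refine ⟨t, LinearMap.ext fun x => ?_⟩
  have h1 := congrArg Subtype.val (LinearMap.congr_fun ht (f x))
  have h2 : (LinearMap.ker q).mkQ (f x) = 0 := by
    rw [← LinearMap.mem_ker, Submodule.ker_mkQ, ← h]
    exact ⟨x, rfl⟩
  refine h1.trans ?_
  change f x - s ((LinearMap.ker q).mkQ (f x)) = f x
  rw [h2, map_zero, sub_zero]

end CompleteModules

/-! ### `Ext` groups from resolutions by finite free modules -/

section FreeResolution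

open Matrix

variable {R : Type u} [Ring R]

/-- The ranks of a cochain complex, shifted so as to begin with the zero module. -/
def prevRank (n : ℕ → ℕ) : ℕ → ℕ
  | 0 => 0
  | i + 1 => n i

/-- The matrix of the differential that arrives in degree `i`; it is zero for `i = 0`. -/
def prevMatrix {n : ℕ → ℕ} (D : ∀ i, Matrix (Fin (n (i + 1))) (Fin (n i)) R) :
    ∀ i, Matrix (Fin (n i)) (Fin (prevRank n i)) R
  | 0 => 0
  | i + 1 => D i

/-- The matrices `D i`, acting on row vectors, and the augmentation form a resolution of `M` by
finite free left `R`-modules. -/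
structure IsFreeResolution {n : ℕ → ℕ} (D : ∀ i, Matrix (Fin (n (i + 1))) (Fin (n i)) R)
    {M : ModuleCat.{u} R} (aug : (Fin (n 0) → R) →ₗ[R] M) : Prop where
  surjective : Function.Surjective aug
  exact_aug : ∀ x, aug x = 0 ↔ ∃ y, y ᵥ* D 0 = x
  exact : ∀ i x, x ᵥ* D i = 0 ↔ ∃ y, y ᵥ* D (i + 1) = x

namespace IsFreeResolution

variable {n : ℕ → ℕ} {D : ∀ i, Matrix (Fin (n (i + 1))) (Fin (n i)) R} {M : ModuleCat.{u} R}
  {aug : (Fin (n 0) → R) →ₗ[R] M}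

theorem mul_eq_zero (h : IsFreeResolution D aug) (i : ℕ) : D (i + 1) * D i = 0 := by
  ext a b
  have := (h.exact i (Pi.single a 1 ᵥ* D (i + 1))).mpr ⟨_, rfl⟩
  rw [vecMul_vecMul, single_one_vecMul] at this
  exact congrFun this b

/-- The chain complex of left modules of a free resolution. -/
def complex (h : IsFreeResolution D aug) : ChainComplex (ModuleCat.{u} R) ℕ :=
  ChainComplex.of (fun i => ModuleCat.of R (Fin (n i) → R))
    (fun i => ModuleCat.ofHom (Matrix.vecMulLinear (D i)))
    fun i => by
      ext : 1
      refine LinearMap.ext fun x => ?_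
      change (x ᵥ* D (i + 1)) ᵥ* D i = 0
      rw [vecMul_vecMul, h.mul_eq_zero, vecMul_zero]

theorem complex_d (h : IsFreeResolution D aug) (i : ℕ) :
    h.complex.d (i + 1) i = ModuleCat.ofHom (Matrix.vecMulLinear (D i)) :=
  ChainComplex.of_d (fun i => ModuleCat.of R (Fin (n i) → R))
    (fun i => ModuleCat.ofHom (Matrix.vecMulLinear (D i))) i

/-- The augmentation of a free resolution as a morphism of chain complexes. -/
def augHom (h : IsFreeResolution D aug) :
    h.complex ⟶ (ChainComplex.single₀ (ModuleCat.{u} R)).obj M :=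
  (ChainComplex.toSingle₀Equiv _ _).symm ⟨ModuleCat.ofHom aug, by
    rw [complex_d]
    ext : 1
    exact LinearMap.ext fun x => (h.exact_aug _).mpr ⟨x, rfl⟩⟩

theorem augHom_f_zero (h : IsFreeResolution D aug) (x : Fin (n 0) → R) :
    (ConcreteCategory.hom (h.augHom.f 0)) x = aug x :=
  congrArg (fun f => (ConcreteCategory.hom f) x)
    (ChainComplex.toSingle₀Equiv_symm_apply_f_zero (C := h.complex) (X := M)
      (ModuleCat.ofHom aug) _)

/-- A free resolution as a projective resolution in the category of left modules. -/
def resolution (h : IsFreeResolution D aug) : ProjectiveResolution M where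
  complex := h.complex
  projective i := ModuleCat.projective_of_free (Pi.basisFun R (Fin (n i)))
  π := h.augHom
  quasiIso := ⟨fun i => by
    cases i with
    | zero =>
      rw [ChainComplex.quasiIsoAt₀_iff, ShortComplex.quasiIso_iff_of_zeros']
      · constructor
        · rw [ShortComplex.moduleCat_exact_iff]
          intro x hx
          obtain ⟨y, hy⟩ := (h.exact_aug x).mp ((h.augHom_f_zero x).symm.trans hx)
          refine ⟨y, ?_⟩
          change (ConcreteCategory.hom (h.complex.d 1 0)) y = x
          rw [complex_d]
          exact hy
        · rw [ModuleCat.epi_iff_surjective]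
          intro m
          obtain ⟨x, hx⟩ := h.surjective m
          exact ⟨x, (h.augHom_f_zero x).trans hx⟩
      all_goals rfl
    | succ i =>
      rw [quasiIsoAt_iff_exactAt']
      · rw [HomologicalComplex.exactAt_iff' _ (i + 2) (i + 1) i (by simp) (by simp),
          ShortComplex.moduleCat_exact_iff]
        intro x hx
        change (ConcreteCategory.hom (h.complex.d (i + 1) i)) x = 0 at hx
        rw [complex_d] at hx
        obtain ⟨y, hy⟩ := (h.exact i x).mp hx
        refine ⟨y, ?_⟩
        change (ConcreteCategory.hom (h.complex.d (i + 2) (i + 1))) y = x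
        rw [complex_d]
        exact hy
      · apply ChainComplex.exactAt_succ_single_obj⟩

/-! ### `Ext` with values in the regular module as cohomology of column vectors. -/

theorem extMk_zero_eq_zero_iff {C : Type*} [Category* C] [Abelian C] [HasExt C] {X Y : C}
    (P : ProjectiveResolution X) (f : P.complex.X 0 ⟶ Y) (hf : P.complex.d 1 0 ≫ f = 0) :
    P.extMk f 1 rfl hf = 0 ↔ f = 0 := by
  rw [← P.extEquivCohomologyClass.apply_eq_iff_eq, P.extEquivCohomologyClass_extMk,
    P.extEquivCohomologyClass_zero, CochainComplex.HomComplex.CohomologyClass.mk_eq_zero_iff,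
    CochainComplex.HomComplex.Cocycle.toSingleMk_mem_coboundaries_iff _ _ _ _ _ 1 (by simp)]
  -- The cochain complex of a projective resolution lives in degrees at most `0`, so nothing can
  -- bound a class of degree `0`.
  have h0 : Limits.IsZero (P.cochainComplex.X 1) :=
    CochainComplex.isZero_of_isStrictlyLE _ 0 _
  constructor
  · rintro ⟨g, hg⟩
    rw [h0.eq_of_src g 0, Limits.comp_zero] at hg
    rw [← cancel_epi (P.cochainComplexXIso (-0) 0 rfl).hom, Limits.comp_zero]
    exact hg.symm
  · rintro rfl
    exact ⟨0, by simp⟩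

/-- The linear form on row vectors that a column vector represents. -/
def toHom (i : ℕ) (y : Fin (n i) → R) :
    ModuleCat.of R (Fin (n i) → R) ⟶ ModuleCat.of R R :=
  ModuleCat.ofHom
    { toFun := fun x => x ⬝ᵥ y
      map_add' := fun x x' => add_dotProduct x x' y
      map_smul' := fun c x => smul_dotProduct c x y }

theorem toHom_surjective (i : ℕ) : Function.Surjective (toHom (R := R) (n := n) i) := by
  intro f
  refine ⟨fun a => f.hom (Pi.single a 1), ?_⟩
  ext : 1
  refine LinearMap.pi_ext' fun a => LinearMap.ext_ring ?_
  exact single_one_dotProduct a (fun a => f.hom (Pi.single a 1))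

theorem toHom_injective (i : ℕ) : Function.Injective (toHom (R := R) (n := n) i) := by
  intro y y' hy
  funext a
  have : (Pi.single a 1 : Fin (n i) → R) ⬝ᵥ y = (Pi.single a 1 : Fin (n i) → R) ⬝ᵥ y' :=
    congrArg (fun f => f.hom (Pi.single a 1)) hy
  rwa [single_one_dotProduct, single_one_dotProduct] at this

theorem toHom_add (i : ℕ) (y y' : Fin (n i) → R) : toHom i (y + y') = toHom i y + toHom i y' := by
  ext : 1
  exact LinearMap.ext fun x => dotProduct_add x y y'

theorem d_comp_toHom (h : IsFreeResolution D aug) (i : ℕ) (y : Fin (n i) → R) :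
    h.resolution.complex.d (i + 1) i ≫ toHom i y = toHom (i + 1) (D i *ᵥ y) := by
  change h.complex.d (i + 1) i ≫ toHom i y = _
  rw [complex_d]
  ext : 1
  exact LinearMap.ext fun x => (dotProduct_mulVec x (D i) y).symm

/-- The class in `Ext^i_R(M, R)` of a cocycle `y`. -/
def extClass (h : IsFreeResolution D aug) (i : ℕ) (y : Fin (n i) → R) (hy : D i *ᵥ y = 0) :
    ExtReg R M i :=
  h.resolution.extMk (toHom i y) (i + 1) rfl (by
    rw [d_comp_toHom, hy]
    ext : 1
    exact LinearMap.ext fun x => dotProduct_zero x)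

theorem extClass_surjective (h : IsFreeResolution D aug) (i : ℕ) (v : ExtReg R M i) :
    ∃ y hy, h.extClass i y hy = v := by
  obtain ⟨f, hf, rfl⟩ := h.resolution.extMk_surjective v (i + 1) rfl
  obtain ⟨y, rfl⟩ := toHom_surjective (R := R) (n := n) i f
  refine ⟨y, ?_, rfl⟩
  have h0 : toHom (R := R) (n := n) (i + 1) 0 = 0 := by
    ext : 1
    exact LinearMap.ext fun x => dotProduct_zero x
  rw [d_comp_toHom] at hf
  exact toHom_injective (n := n) (i + 1) (hf.trans h0.symm)

theorem extClass_add (h : IsFreeResolution D aug) (i : ℕ) (y y' : Fin (n i) → R)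
    (hy : D i *ᵥ y = 0) (hy' : D i *ᵥ y' = 0) :
    h.extClass i (y + y') (by rw [mulVec_add, hy, hy', add_zero]) =
      h.extClass i y hy + h.extClass i y' hy' := by
  refine Eq.trans ?_ (h.resolution.add_extMk _ _ _ _ _ _).symm
  simp only [extClass, toHom_add]
  rfl

/-- The right module structure is composition with right multiplication on `R`; on the form `x ↦ x
⬝ᵥ y` this multiplies the entries of the column `y` on the right. -/
theorem extClass_mul (h : IsFreeResolution D aug) (i : ℕ) (y : Fin (n i) → R)
    (hy : D i *ᵥ y = 0) (a : R) (hya : D i *ᵥ (fun j => y j * a) = 0) :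
    h.extClass i (fun j => y j * a) hya = MulOpposite.op a • h.extClass i y hy := by
  refine Eq.trans ?_ (h.resolution.extMk_comp_mk₀ _ _ _ _ _).symm
  have : toHom i (fun j => y j * a) = toHom i y ≫ rightMul R a := by
    ext : 1
    refine LinearMap.ext fun x => ?_
    change x ⬝ᵥ (fun j => y j * a) = (x ⬝ᵥ y) * a
    simp [dotProduct, Finset.sum_mul, mul_assoc]
  simp only [extClass, this]
  rfl

/-- Coboundaries are the image of the incoming differential. With `prevMatrix`, which has no columns
in degree `0`, the criterion is uniform in the degree. -/
theorem extClass_eq_zero_iff (h : IsFreeResolution D aug) (i : ℕ) (y : Fin (n i) → R)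
    (hy : D i *ᵥ y = 0) : h.extClass i y hy = 0 ↔ ∃ z, prevMatrix D i *ᵥ z = y := by
  cases i with
  | zero =>
    have h0 : toHom (R := R) (n := n) 0 0 = 0 := by
      ext : 1
      exact LinearMap.ext fun x => dotProduct_zero x
    refine (extMk_zero_eq_zero_iff h.resolution (toHom 0 y) _).trans ⟨fun hy0 => ?_, ?_⟩
    · exact ⟨0, by rw [mulVec_zero]; exact (toHom_injective (n := n) 0 (hy0.trans h0.symm)).symm⟩
    · rintro ⟨z, rfl⟩
      exact (congrArg (toHom 0) (zero_mulVec z)).trans h0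
  | succ i =>
    refine (h.resolution.extMk_eq_zero_iff _ _ _ _ i rfl).trans ⟨?_, ?_⟩
    · rintro ⟨g, hg⟩
      obtain ⟨z, rfl⟩ := toHom_surjective (R := R) (n := n) i g
      rw [d_comp_toHom] at hg
      exact ⟨z, toHom_injective (n := n) (i + 1) hg⟩
    · rintro ⟨z, rfl⟩
      exact ⟨toHom i z, h.d_comp_toHom i z⟩

end IsFreeResolution

end FreeResolution

/-! ### Completed tensor products: functoriality -/

namespace CTensor

section Functoriality

variable {k M N P Q M' N' M'' N'' : Type u} [Field k] [AddCommGroup M] [Module k⟦X⟧ M]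
  [AddCommGroup N] [Module k⟦X⟧ N] [AddCommGroup P] [Module k⟦X⟧ P] [AddCommGroup Q]
  [Module k⟦X⟧ Q] [AddCommGroup M'] [Module k⟦X⟧ M'] [AddCommGroup N'] [Module k⟦X⟧ N']
  [AddCommGroup M''] [Module k⟦X⟧ M''] [AddCommGroup N''] [Module k⟦X⟧ N'']

theorem hom_ext_assoc [IsHausdorff (hIdeal k) Q] {f g : CTensor k (CTensor k M N) P →ₗ[k⟦X⟧] Q}
    (h : ∀ m n p, f (mk (mk m n) p) = g (mk (mk m n) p)) : f = g := by
  refine hom_ext fun t p => ?_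
  have : f ∘ₗ mk.flip p = g ∘ₗ mk.flip p := hom_ext fun m n => h m n p
  exact LinearMap.congr_fun this t

theorem map_comp (f : M →ₗ[k⟦X⟧] M') (g : N →ₗ[k⟦X⟧] N') (f' : M' →ₗ[k⟦X⟧] M'')
    (g' : N' →ₗ[k⟦X⟧] N'') : map (f' ∘ₗ f) (g' ∘ₗ g) = map f' g' ∘ₗ map f g :=
  hom_ext fun m n => by simp

theorem map_id : map (LinearMap.id : M →ₗ[k⟦X⟧] M) (LinearMap.id : N →ₗ[k⟦X⟧] N) =
    LinearMap.id :=
  hom_ext fun m n => by simp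

theorem map_zero_left (g : N →ₗ[k⟦X⟧] N') : map (0 : M →ₗ[k⟦X⟧] M') g = 0 :=
  hom_ext fun m n => by simp

theorem map_add_left (f f' : M →ₗ[k⟦X⟧] M') (g : N →ₗ[k⟦X⟧] N') :
    map (f + f') g = map f g + map f' g :=
  hom_ext fun m n => by simp

variable (k M N) in
/-- Completed tensor products commute with finite powers. -/
def piEquiv (n : ℕ) : CTensor k (Fin n → M) N ≃ₗ[k⟦X⟧] (Fin n → CTensor k M N) :=
  LinearEquiv.ofLinearMap
    (LinearMap.pi fun i => map (LinearMap.proj i) LinearMap.id)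
    (∑ i, map (LinearMap.single k⟦X⟧ (fun _ => M) i) LinearMap.id ∘ₗ LinearMap.proj i)
    (by
      refine LinearMap.ext fun y => funext fun j => ?_
      simp only [LinearMap.comp_apply, LinearMap.sum_apply, LinearMap.pi_apply,
        LinearMap.proj_apply,
        LinearMap.id_apply, map_sum]
      have (i : Fin n) : map (LinearMap.proj (R := k⟦X⟧) (φ := fun _ : Fin n => M) j) LinearMap.id
          (map (LinearMap.single k⟦X⟧ (fun _ => M) i) (LinearMap.id : N →ₗ[k⟦X⟧] N) (y i)) =
            if i = j then y j else 0 := by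
        rw [← LinearMap.comp_apply, ← map_comp, LinearMap.comp_id]
        split_ifs with hij
        · subst hij
          rw [LinearMap.proj_comp_single_same, map_id, LinearMap.id_apply]
        · rw [LinearMap.proj_comp_single_ne k⟦X⟧ (fun _ : Fin n => M) j i (Ne.symm hij),
            map_zero_left, LinearMap.zero_apply]
      simp [this])
    (hom_ext fun m n => by
      simp only [LinearMap.comp_apply, LinearMap.sum_apply, LinearMap.pi_apply,
        LinearMap.proj_apply,
        LinearMap.id_apply, map_mk, ← LinearMap.map_sum₂]
      congr 2
      simpa using Finset.univ_sum_single m)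

@[simp] theorem piEquiv_mk (n : ℕ) (m : Fin n → M) (y : N) (i : Fin n) :
    piEquiv k M N n (mk m y) i = mk (m i) y := by
  simp [piEquiv]

end Functoriality

section MulLift

variable {k M N B : Type u} [Field k] [AddCommGroup M] [Module k⟦X⟧ M]
  [AddCommGroup N] [Module k⟦X⟧ N] [Ring B] [Algebra k⟦X⟧ B] [IsAdicComplete (hIdeal k) B]

/-- The map `m ⊗ n ↦ f(m) g(n)` to a complete algebra. -/
def mulLift (f : M →ₗ[k⟦X⟧] B) (g : N →ₗ[k⟦X⟧] B) : CTensor k M N →ₗ[k⟦X⟧] B :=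
  lift ((LinearMap.mul k⟦X⟧ B).compl₁₂ f g)

@[simp] theorem mulLift_mk (f : M →ₗ[k⟦X⟧] B) (g : N →ₗ[k⟦X⟧] B) (m : M) (n : N) :
    mulLift f g (mk m n) = f m * g n := by
  simp [mulLift]

end MulLift

section AlgebraMaps

variable {k A B A' B' : Type u} [Field k] [Ring A] [Algebra k⟦X⟧ A] [Ring B] [Algebra k⟦X⟧ B]
  [Ring A'] [Algebra k⟦X⟧ A'] [Ring B'] [Algebra k⟦X⟧ B']

variable (k A B) in
/-- The homomorphism `a ↦ a ⊗ 1`. -/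
def inl : A →ₐ[k⟦X⟧] CTensor k A B :=
  AlgHom.ofLinearMap (mk.flip 1) rfl fun a b => by simp

variable (k A B) in
/-- The homomorphism `b ↦ 1 ⊗ b`. -/
def inr : B →ₐ[k⟦X⟧] CTensor k A B :=
  AlgHom.ofLinearMap (mk 1) rfl fun a b => by simp

@[simp] theorem inl_apply (a : A) : inl k A B a = mk (k := k) a 1 := rfl

@[simp] theorem inr_apply (b : B) : inr k A B b = mk (k := k) 1 b := rfl

/-- A linear map out of a completed tensor product of algebras is multiplicative if it is so on
the tensors `a ⊗ b`. -/
theorem map_mul_of_mk {C : Type u} [Ring C] [Algebra k⟦X⟧ C] [IsHausdorff (hIdeal k) C]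
    (φ : CTensor k A B →ₗ[k⟦X⟧] C)
    (h : ∀ a b a' b',
      φ (mk (k := k) a b * mk (k := k) a' b') = φ (mk (k := k) a b) * φ (mk (k := k) a' b'))
    (x y : CTensor k A B) :
    φ (x * y) = φ x * φ y := by
  have h1 (a : A) (b : B) : φ ∘ₗ LinearMap.mulLeft k⟦X⟧ (mk a b) =
      LinearMap.mulLeft k⟦X⟧ (φ (mk a b)) ∘ₗ φ := hom_ext fun a' b' => h a b a' b'
  have h2 : φ ∘ₗ LinearMap.mulRight k⟦X⟧ y = LinearMap.mulRight k⟦X⟧ (φ y) ∘ₗ φ :=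
    hom_ext fun a b => LinearMap.congr_fun (h1 a b) y
  exact LinearMap.congr_fun h2 x

/-- The completed tensor product of two homomorphisms of algebras. -/
def mapAlg (f : A →ₐ[k⟦X⟧] A') (g : B →ₐ[k⟦X⟧] B') : CTensor k A B →ₐ[k⟦X⟧] CTensor k A' B' :=
  AlgHom.ofLinearMap (map f.toLinearMap g.toLinearMap)
    (by rw [one_def, map_mk, one_def]; simp)
    (map_mul_of_mk _ fun a b a' b' => by simp)

end AlgebraMaps

end CTensor

/-! ### Convolution and the antipode -/

namespace TopHopf

section Convolution

variable {k A B C : Type u} [Field k] [Ring A] [Algebra k⟦X⟧ A] [IsAdicComplete (hIdeal k) A]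
  [Ring B] [Algebra k⟦X⟧ B] [Ring C] [Algebra k⟦X⟧ C] (H : TopHopf k A)

variable (B) in
/-- The unit `a ↦ ε(a) 1` of the convolution product. -/
def convOne : A →ₗ[k⟦X⟧] B := Algebra.linearMap k⟦X⟧ B ∘ₗ H.counit.toLinearMap

theorem comp_convOne (φ : B →ₐ[k⟦X⟧] C) : φ.toLinearMap ∘ₗ H.convOne B = H.convOne C := by
  ext a
  simp [convOne]

variable [IsAdicComplete (hIdeal k) B] [IsAdicComplete (hIdeal k) C]

/-- The convolution product `a ↦ ∑ f(a') g(a'')`. -/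
def conv (f g : A →ₗ[k⟦X⟧] B) : A →ₗ[k⟦X⟧] B :=
  CTensor.mulLift f g ∘ₗ H.comul.toLinearMap

theorem conv_apply (f g : A →ₗ[k⟦X⟧] B) (a : A) :
    H.conv f g a = CTensor.mulLift f g (H.comul a) := rfl

/-- Both sides are the triple product `f(a') g(a'') h(a''')`, evaluated on the two sides of
coassociativity. -/
theorem conv_assoc (f g h : A →ₗ[k⟦X⟧] B) : H.conv (H.conv f g) h = H.conv f (H.conv g h) := by
  ext a
  have h1 : CTensor.mulLift (H.conv f g) h =
      CTensor.mulLift (CTensor.mulLift f g) h ∘ₗ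
        CTensor.map H.comul.toLinearMap LinearMap.id :=
    CTensor.hom_ext fun m n => by simp [conv]
  have h2 : CTensor.mulLift f (H.conv g h) =
      CTensor.mulLift f
        (CTensor.mulLift g h) ∘ₗ
        CTensor.map LinearMap.id H.comul.toLinearMap :=
    CTensor.hom_ext fun m n => by simp [conv]
  have h3 : CTensor.mulLift (CTensor.mulLift f g) h =
      CTensor.mulLift f
        (CTensor.mulLift g h) ∘ₗ CTensor.assoc :=
    CTensor.hom_ext_assoc fun m n p => by simp [mul_assoc]
  rw [conv_apply, conv_apply, h1, h2, h3, LinearMap.comp_apply, LinearMap.comp_apply,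
    LinearMap.comp_apply, H.coassoc]

theorem convOne_conv (g : A →ₗ[k⟦X⟧] B) : H.conv (H.convOne B) g = g := by
  ext a
  have : CTensor.mulLift (H.convOne B) g =
      g ∘ₗ CTensor.lift (LinearMap.lsmul k⟦X⟧ A ∘ₗ H.counit.toLinearMap) :=
    CTensor.hom_ext fun m n => by simp [convOne, ← Algebra.smul_def]
  rw [conv_apply, this, LinearMap.comp_apply, H.counit_comul]

theorem conv_convOne (g : A →ₗ[k⟦X⟧] B) : H.conv g (H.convOne B) = g := by
  ext a
  have : CTensor.mulLift g (H.convOne B) =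
      g ∘ₗ CTensor.lift (LinearMap.lsmul k⟦X⟧ A ∘ₗ H.counit.toLinearMap).flip :=
    CTensor.hom_ext fun m n => by
      simp [convOne, ← Algebra.smul_def, ← Algebra.commutes (R := k⟦X⟧) (A := B)]
  rw [conv_apply, this, LinearMap.comp_apply, H.comul_counit]

theorem comp_conv (φ : B →ₐ[k⟦X⟧] C) (f g : A →ₗ[k⟦X⟧] B) :
    φ.toLinearMap ∘ₗ H.conv f g = H.conv (φ.toLinearMap ∘ₗ f) (φ.toLinearMap ∘ₗ g) := by
  have : φ.toLinearMap ∘ₗ CTensor.mulLift f g =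
      CTensor.mulLift (φ.toLinearMap ∘ₗ f) (φ.toLinearMap ∘ₗ g) :=
    CTensor.hom_ext fun m n => by simp
  rw [conv, ← LinearMap.comp_assoc, this, conv]

theorem mulLeft_comp_conv (c : B) (f g : A →ₗ[k⟦X⟧] B) :
    H.conv (LinearMap.mulLeft k⟦X⟧ c ∘ₗ f) g = LinearMap.mulLeft k⟦X⟧ c ∘ₗ H.conv f g := by
  have : CTensor.mulLift (LinearMap.mulLeft k⟦X⟧ c ∘ₗ f) g =
      LinearMap.mulLeft k⟦X⟧ c ∘ₗ CTensor.mulLift f g :=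
    CTensor.hom_ext fun m n => by simp [mul_assoc]
  rw [conv, this, conv, LinearMap.comp_assoc]

theorem conv_antipode_id : H.conv H.antipode LinearMap.id = H.convOne A := by
  ext a
  exact H.antipode_mul a

theorem conv_id_antipode : H.conv LinearMap.id H.antipode = H.convOne A := by
  ext a
  exact H.mul_antipode a

theorem antipode_one : H.antipode 1 = 1 := by
  have := H.antipode_mul 1
  rw [map_one H.comul, map_one H.counit, map_one (algebraMap k⟦X⟧ A), CTensor.one_def,
    CTensor.lift_mk] at this
  simpa using this

/-- The uniqueness of convolution inverses, used in one variable at a time so that no coproduct on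
`A ⊗̂ A` is needed. Start from `∑ S(a'b') a''b'' = ε(ab)`. Convolution with `S` in `b` gives `∑
S(a'b) a'' = ε(a) S(b)`; convolution with `S` in `a` then gives `S(ab) = S(b) S(a)`. The auxiliary
map is `G(x ⊗ y)(b) = S(xb) y`. -/
theorem antipode_mul_rev (a b : A) : H.antipode (a * b) = H.antipode b * H.antipode a := by
  let G : CTensor k A A →ₗ[k⟦X⟧] A →ₗ[k⟦X⟧] A := CTensor.liftHom (LinearMap.mk₂ k⟦X⟧
    (fun x y => LinearMap.mulRight k⟦X⟧ y ∘ₗ H.antipode ∘ₗ LinearMap.mulLeft k⟦X⟧ x)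
    (by intros; ext; simp [add_mul]) (by intros; ext; simp)
    (by intros; ext; simp [mul_add]) (by intros; ext; simp))
  have hG (x y b : A) : G (CTensor.mk x y) b = H.antipode (x * b) * y := by simp [G]
  have h1 (t s : CTensor k A A) : CTensor.mulLift (G t) LinearMap.id s
      = CTensor.lift (LinearMap.mul k⟦X⟧ A ∘ₗ H.antipode) (t * s) := by
    have h3 : CTensor.mulLift (G t) LinearMap.id =
        CTensor.lift (LinearMap.mul k⟦X⟧ A ∘ₗ H.antipode) ∘ₗ LinearMap.mulLeft k⟦X⟧ t := by
      refine CTensor.hom_ext fun x y => ?_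
      have h4 : LinearMap.mulRight k⟦X⟧ y ∘ₗ G.flip x =
          CTensor.lift (LinearMap.mul k⟦X⟧ A ∘ₗ H.antipode) ∘ₗ
            LinearMap.mulRight k⟦X⟧ (CTensor.mk x y) :=
        CTensor.hom_ext fun a b => by simp [hG, mul_assoc]
      simpa using LinearMap.congr_fun h4 t
    exact LinearMap.congr_fun h3 s
  have h5 (a : A) : G (H.comul a) = LinearMap.mulLeft k⟦X⟧ (H.convOne A a) ∘ₗ H.antipode := by
    have : H.conv (G (H.comul a)) LinearMap.id =
        LinearMap.mulLeft k⟦X⟧ (H.convOne A a) ∘ₗ H.convOne A := by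
      ext b
      rw [conv_apply, h1, ← map_mul, H.antipode_mul, map_mul, map_mul]
      rfl
    rw [← H.conv_convOne (G (H.comul a)), ← conv_id_antipode, ← conv_assoc, this,
      mulLeft_comp_conv, convOne_conv, conv_id_antipode]
  have h6 (b : A) : H.conv (H.antipode ∘ₗ LinearMap.mulRight k⟦X⟧ b) LinearMap.id =
      LinearMap.mulLeft k⟦X⟧ (H.antipode b) ∘ₗ H.convOne A := by
    ext a
    have h7 : CTensor.mulLift (H.antipode ∘ₗ LinearMap.mulRight k⟦X⟧ b) LinearMap.id = G.flip b :=
      CTensor.hom_ext fun x y => by simp [hG]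
    rw [conv_apply, h7, LinearMap.flip_apply, h5]
    exact Algebra.commutes (H.counit a) (H.antipode b)
  have h8 : H.antipode ∘ₗ LinearMap.mulRight k⟦X⟧ b =
      LinearMap.mulLeft k⟦X⟧ (H.antipode b) ∘ₗ H.antipode := by
    rw [← H.conv_convOne (H.antipode ∘ₗ LinearMap.mulRight k⟦X⟧ b), ← conv_id_antipode,
      ← conv_assoc, h6, mulLeft_comp_conv, convOne_conv]
  exact LinearMap.congr_fun h8 a

/-- The antipode as a homomorphism to the opposite algebra. -/
def antipodeOp : A →ₐ[k⟦X⟧] Aᵐᵒᵖ :=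
  AlgHom.ofLinearMap ((MulOpposite.opLinearEquiv k⟦X⟧).toLinearMap ∘ₗ H.antipode)
    (by simp [antipode_one]) (fun a b => by simp [antipode_mul_rev])

@[simp] theorem antipodeOp_apply (a : A) : H.antipodeOp a = MulOpposite.op (H.antipode a) := rfl

end Convolution

end TopHopf

/-! ### Untwisting the enveloping algebra -/

namespace CTensor

variable {k A B : Type u} [Field k] [Ring A] [Algebra k⟦X⟧ A] [Ring B] [Algebra k⟦X⟧ B]

/-- The map `x ⊗ y ↦ α(x) (1 ⊗ y)`, for `α : A → A ⊗̂ B`. -/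
def inrExtend (α : A →ₗ[k⟦X⟧] CTensor k A B) : CTensor k A B →ₗ[k⟦X⟧] CTensor k A B :=
  mulLift α (inr k A B).toLinearMap

@[simp] theorem inrExtend_mk (α : A →ₗ[k⟦X⟧] CTensor k A B) (x : A) (y : B) :
    inrExtend α (mk x y) = α x * mk (k := k) 1 y := by
  simp [inrExtend]

theorem inrExtend_mul_inr (α : A →ₗ[k⟦X⟧] CTensor k A B) (t : CTensor k A B) (y : B) :
    inrExtend α (t * inr k A B y) = inrExtend α t * inr k A B y := by
  have : inrExtend α ∘ₗ LinearMap.mulRight k⟦X⟧ (inr k A B y) =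
      LinearMap.mulRight k⟦X⟧ (inr k A B y) ∘ₗ inrExtend α :=
    hom_ext fun a b => by simp [mul_assoc]
  exact LinearMap.congr_fun this t

theorem inrExtend_comp_inl (α : A →ₗ[k⟦X⟧] CTensor k A B) :
    inrExtend α ∘ₗ (inl k A B).toLinearMap = α := by
  refine LinearMap.ext fun a => ?_
  change inrExtend α (mk a 1) = α a
  rw [inrExtend_mk, ← one_def, mul_one]

variable (k A) in
/-- The isomorphism `x ⊗ y ↦ x ⊗ y` from `A ⊗̂ A` to the enveloping algebra. -/
def opEquiv : CTensor k A A ≃ₗ[k⟦X⟧] Env k A :=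
  LinearEquiv.ofLinearMap
    (map LinearMap.id (MulOpposite.opLinearEquiv k⟦X⟧).toLinearMap)
    (map LinearMap.id (MulOpposite.opLinearEquiv k⟦X⟧).symm.toLinearMap)
    (hom_ext fun a b => by simp) (hom_ext fun a b => by simp)

@[simp] theorem opEquiv_mk (a b : A) : opEquiv k A (mk a b) = mk (k := k) a (MulOpposite.op b) := by
  simp [opEquiv]

/-- Passing to `Aᵒᵖ` in the second factor exchanges the side on which `1 ⊗ y` multiplies; this is
the origin of the order of the factors in `(1 ⊗ y) δ(x)`. -/
theorem opEquiv_mul_inr (t : CTensor k A A) (y : A) :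
    opEquiv k A (t * inr k A A y) = inr k A Aᵐᵒᵖ (MulOpposite.op y) * opEquiv k A t := by
  have : (opEquiv k A).toLinearMap ∘ₗ LinearMap.mulRight k⟦X⟧ (inr k A A y) =
      LinearMap.mulLeft k⟦X⟧ (inr k A Aᵐᵒᵖ (MulOpposite.op y)) ∘ₗ (opEquiv k A).toLinearMap :=
    hom_ext fun a b => by simp
  exact LinearMap.congr_fun this t

end CTensor

namespace TopHopf

variable {k A B : Type u} [Field k] [Ring A] [Algebra k⟦X⟧ A] [IsAdicComplete (hIdeal k) A]
  [Ring B] [Algebra k⟦X⟧ B] (H : TopHopf k A)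

/-- The map `a ↦ ∑ a' ⊗ g(a'')`. -/
def graph (g : A →ₗ[k⟦X⟧] B) : A →ₗ[k⟦X⟧] CTensor k A B :=
  H.conv (CTensor.inl k A B).toLinearMap ((CTensor.inr k A B).toLinearMap ∘ₗ g)

theorem graph_eq (g : A →ₗ[k⟦X⟧] B) :
    H.graph g = CTensor.map LinearMap.id g ∘ₗ H.comul.toLinearMap := by
  have : CTensor.map (LinearMap.id : A →ₗ[k⟦X⟧] A) g =
      CTensor.mulLift (CTensor.inl k A B).toLinearMap ((CTensor.inr k A B).toLinearMap ∘ₗ g) :=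
    CTensor.hom_ext fun m n => by simp
  rw [this]
  rfl

theorem comp_conv_of_mul {E : Type u} [Ring E] [Algebra k⟦X⟧ E] [IsAdicComplete (hIdeal k) E]
    (T : E →ₗ[k⟦X⟧] E) (j : B →ₗ[k⟦X⟧] E) (hT : ∀ t y, T (t * j y) = T t * j y)
    (f : A →ₗ[k⟦X⟧] E) (g : A →ₗ[k⟦X⟧] B) :
    T ∘ₗ H.conv f (j ∘ₗ g) = H.conv (T ∘ₗ f) (j ∘ₗ g) := by
  have : T ∘ₗ CTensor.mulLift f (j ∘ₗ g) = CTensor.mulLift (T ∘ₗ f) (j ∘ₗ g) :=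
    CTensor.hom_ext fun m n => by simp [hT]
  rw [conv, ← LinearMap.comp_assoc, this, conv]

theorem inrExtend_comp_conv (α : A →ₗ[k⟦X⟧] CTensor k A B) (f : A →ₗ[k⟦X⟧] CTensor k A B)
    (g : A →ₗ[k⟦X⟧] B) :
    CTensor.inrExtend α ∘ₗ H.conv f ((CTensor.inr k A B).toLinearMap ∘ₗ g) =
      H.conv (CTensor.inrExtend α ∘ₗ f) ((CTensor.inr k A B).toLinearMap ∘ₗ g) :=
  H.comp_conv_of_mul (CTensor.inrExtend α) (CTensor.inr k A B).toLinearMap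
    (CTensor.inrExtend_mul_inr α) f g

/-- `g'` is a right convolution inverse of `g`, in the completed tensor product. -/
def IsConvInverse (g g' : A →ₗ[k⟦X⟧] B) : Prop :=
  H.conv ((CTensor.inr k A B).toLinearMap ∘ₗ g) ((CTensor.inr k A B).toLinearMap ∘ₗ g') =
    H.convOne (CTensor k A B)

theorem graph_conv {g g' : A →ₗ[k⟦X⟧] B} (h : H.IsConvInverse g g') :
    H.conv (H.graph g) ((CTensor.inr k A B).toLinearMap ∘ₗ g') =
      (CTensor.inl k A B).toLinearMap := by
  rw [graph, conv_assoc, h, conv_convOne]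

/-- Both maps commute with right multiplication by `1 ⊗ y`, so it suffices to treat `x ⊗ 1`, where
the composite is `∑ x' ⊗ g(x'') g'(x''') = x ⊗ 1`. -/
theorem inrExtend_graph_comp {g g' : A →ₗ[k⟦X⟧] B} (h : H.IsConvInverse g g') :
    CTensor.inrExtend (H.graph g) ∘ₗ CTensor.inrExtend (H.graph g') = LinearMap.id := by
  refine CTensor.hom_ext fun x y => ?_
  have h1 : CTensor.inrExtend (H.graph g) ∘ₗ H.graph g' = (CTensor.inl k A B).toLinearMap := by
    conv_lhs => rw [graph.eq_1 H g']
    rw [inrExtend_comp_conv, CTensor.inrExtend_comp_inl, H.graph_conv h]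
  have h2 := LinearMap.congr_fun h1 x
  simp only [LinearMap.comp_apply] at h2 ⊢
  rw [CTensor.inrExtend_mk, ← CTensor.inr_apply, CTensor.inrExtend_mul_inr, h2]
  simp

/-- The isomorphism `x ⊗ y ↦ ∑ x' ⊗ g(x'') y`, for a convolution invertible `g`. -/
def graphEquiv (g g' : A →ₗ[k⟦X⟧] B) (h : H.IsConvInverse g g') (h' : H.IsConvInverse g' g) :
    CTensor k A B ≃ₗ[k⟦X⟧] CTensor k A B :=
  LinearEquiv.ofLinearMap (CTensor.inrExtend (H.graph g)) (CTensor.inrExtend (H.graph g'))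
    (H.inrExtend_graph_comp h) (H.inrExtend_graph_comp h')

/-- The homomorphism `δ : A → A ⊗̂ Aᵒᵖ`, `a ↦ ∑ a' ⊗ S(a'')`. -/
def delta : A →ₐ[k⟦X⟧] Env k A :=
  (CTensor.mapAlg (AlgHom.id k⟦X⟧ A) H.antipodeOp).comp H.comul

theorem delta_toLinearMap : H.delta.toLinearMap = H.graph H.antipodeOp.toLinearMap :=
  (H.graph_eq _).symm

theorem isConvInverse_antipode : H.IsConvInverse H.antipode LinearMap.id := by
  rw [IsConvInverse, ← comp_conv, conv_antipode_id, comp_convOne]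

theorem isConvInverse_id : H.IsConvInverse LinearMap.id H.antipode := by
  rw [IsConvInverse, ← comp_conv, conv_id_antipode, comp_convOne]

/-- Apply the homomorphism `antipodeOp` to `id * S = ε`: with values in `Aᵒᵖ`, the convolution
inverse of `S` is `S²`. -/
theorem isConvInverse_antipodeOp : H.IsConvInverse H.antipodeOp.toLinearMap
    (H.antipodeOp.toLinearMap ∘ₗ H.antipode) := by
  have := H.comp_conv ((CTensor.inr k A Aᵐᵒᵖ).comp H.antipodeOp) LinearMap.id H.antipode
  rw [conv_id_antipode, comp_convOne] at this
  exact this.symm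

theorem isConvInverse_antipodeOp' : H.IsConvInverse (H.antipodeOp.toLinearMap ∘ₗ H.antipode)
    H.antipodeOp.toLinearMap := by
  have := H.comp_conv ((CTensor.inr k A Aᵐᵒᵖ).comp H.antipodeOp) H.antipode LinearMap.id
  rw [conv_antipode_id, comp_convOne] at this
  exact this.symm

/-- The isomorphism `x ⊗ y ↦ (1 ⊗ y) δ(x)`. -/
def rightUntwist : CTensor k A A ≃ₗ[k⟦X⟧] Env k A :=
  (H.graphEquiv _ _ H.isConvInverse_antipode H.isConvInverse_id).trans (CTensor.opEquiv k A)

/-- Shows `A ⊗̂ Aᵒᵖ` as a topologically free right `A`-module through `δ`, which makes induction of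
split complexes along `δ` exact. -/
theorem rightUntwist_mk (x y : A) :
    H.rightUntwist (CTensor.mk x y) = CTensor.mk (k := k) 1 (MulOpposite.op y) * H.delta x := by
  have h1 : (CTensor.opEquiv k A).toLinearMap ∘ₗ H.graph H.antipode = H.delta.toLinearMap := by
    rw [delta_toLinearMap, graph_eq, graph_eq, ← LinearMap.comp_assoc]
    congr 1
    exact CTensor.hom_ext fun a b => by simp
  change CTensor.opEquiv k A (CTensor.inrExtend (H.graph H.antipode) (CTensor.mk x y)) = _
  rw [CTensor.inrExtend_mk, ← CTensor.inr_apply, CTensor.opEquiv_mul_inr, CTensor.inr_apply]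
  exact congrArg _ (LinearMap.congr_fun h1 x)

/-- The isomorphism `x ⊗ y ↦ δ(x) (1 ⊗ y)`. -/
def leftUntwist : Env k A ≃ₗ[k⟦X⟧] Env k A :=
  H.graphEquiv _ _ H.isConvInverse_antipodeOp H.isConvInverse_antipodeOp'

/-- The same for the left module structure through `δ`; it serves for the dual complex, where the
matrices act on columns from the left. -/
theorem leftUntwist_mk (x : A) (y : Aᵐᵒᵖ) :
    H.leftUntwist (CTensor.mk x y) = H.delta x * CTensor.mk (k := k) 1 y := by
  change CTensor.inrExtend (H.graph H.antipodeOp.toLinearMap) (CTensor.mk x y) = _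
  rw [CTensor.inrExtend_mk, ← delta_toLinearMap]
  rfl

/-- `a ⊗ 1 = ∑ δ(a') (1 ⊗ S²(a''))`. -/
theorem lift_delta_comul (a : A) :
    CTensor.mulLift H.delta.toLinearMap
      ((CTensor.inr k A Aᵐᵒᵖ).toLinearMap ∘ₗ H.antipodeOp.toLinearMap ∘ₗ H.antipode) (H.comul a) =
      CTensor.mk (k := k) a 1 := by
  have := LinearMap.congr_fun (H.graph_conv H.isConvInverse_antipodeOp) a
  rwa [← delta_toLinearMap] at this

/-- This is `∑ a' S(a'') = ε(a)`. Restricted along `δ`, the element `1` of the bimodule `A` spans a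
trivial module; so `A` is the bimodule induced from `K`. -/
theorem delta_smul_one (a : A) : H.delta a • (1 : A) = algebraMap k⟦X⟧ A (H.counit a) := by
  have : (envAct k A).flip 1 ∘ₗ CTensor.map LinearMap.id H.antipodeOp.toLinearMap =
      CTensor.lift ((LinearMap.mul k⟦X⟧ A).compl₂ H.antipode) :=
    CTensor.hom_ext fun a b => by simp
  exact (LinearMap.congr_fun this (H.comul a)).trans (H.mul_antipode a)

end TopHopf

/-! ### Split exact sequences and completed tensor products -/

section Splitting

variable {k X Y Z N : Type u} [Field k] [AddCommGroup X] [Module k⟦X⟧ X] [AddCommGroup Y]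
  [Module k⟦X⟧ Y] [AddCommGroup Z] [Module k⟦X⟧ Z] [AddCommGroup N] [Module k⟦X⟧ N]

/-- Subtracting `t (g y)` from `y` leaves an element of the kernel of `g`, hence of the image of
`f`, and there `f ∘ s` is the identity. The result is an identity between maps, which tensor
products preserve. -/
theorem exists_splitting {f : X →ₗ[k⟦X⟧] Y} {g : Y →ₗ[k⟦X⟧] Z}
    (hfg : ∀ y, g y = 0 → ∃ x, f x = y) (hf : ∃ s : Y →ₗ[k⟦X⟧] X, f ∘ₗ s ∘ₗ f = f)
    (hg : ∃ t : Z →ₗ[k⟦X⟧] Y, g ∘ₗ t ∘ₗ g = g) :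
    ∃ (a : Y →ₗ[k⟦X⟧] X) (b : Z →ₗ[k⟦X⟧] Y), f ∘ₗ a + b ∘ₗ g = LinearMap.id := by
  obtain ⟨s, hs⟩ := hf
  obtain ⟨t, ht⟩ := hg
  refine ⟨s ∘ₗ (LinearMap.id - t ∘ₗ g), t, LinearMap.ext fun y => ?_⟩
  have h1 : g (y - t (g y)) = 0 := by
    rw [map_sub, sub_eq_zero]
    exact (LinearMap.congr_fun ht y).symm
  obtain ⟨x, hx⟩ := hfg _ h1
  have h2 : f (s (y - t (g y))) = y - t (g y) := by
    rw [← hx]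
    exact LinearMap.congr_fun hs x
  change f (s (y - t (g y))) + t (g y) = y
  rw [h2, sub_add_cancel]

theorem CTensor.exists_map_eq {f : X →ₗ[k⟦X⟧] Y} {g : Y →ₗ[k⟦X⟧] Z}
    (h : ∃ (a : Y →ₗ[k⟦X⟧] X) (b : Z →ₗ[k⟦X⟧] Y), f ∘ₗ a + b ∘ₗ g = LinearMap.id)
    (y : CTensor k Y N) (hy : CTensor.map g LinearMap.id y = 0) :
    ∃ x : CTensor k X N, CTensor.map f LinearMap.id x = y := by
  obtain ⟨a, b, hab⟩ := h
  refine ⟨CTensor.map a LinearMap.id y, ?_⟩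
  have : CTensor.map f LinearMap.id ∘ₗ CTensor.map a LinearMap.id +
      CTensor.map b LinearMap.id ∘ₗ CTensor.map g LinearMap.id =
        (LinearMap.id : CTensor k Y N →ₗ[k⟦X⟧] _) := by
    rw [← CTensor.map_comp, ← CTensor.map_comp, LinearMap.comp_id, ← CTensor.map_add_left, hab,
      CTensor.map_id]
  have := LinearMap.congr_fun this y
  simpa [hy] using this

end Splitting

/-! ### Matrices over a `k⟦h⟧`-algebra -/

section Matrices

open Matrix

variable {k A B : Type u} [Field k] [Ring A] [Algebra k⟦X⟧ A] [Ring B] [Algebra k⟦X⟧ B]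

variable (k) in
/-- A matrix acting on row vectors, as a `k⟦h⟧`-linear map. -/
def rowMap {m n : ℕ} (D : Matrix (Fin m) (Fin n) A) : (Fin m → A) →ₗ[k⟦X⟧] (Fin n → A) where
  toFun x := x ᵥ* D
  map_add' x y := add_vecMul D x y
  map_smul' c x := smul_vecMul c x D

variable (k) in
/-- A matrix acting on column vectors, as a `k⟦h⟧`-linear map. -/
def colMap {m n : ℕ} (D : Matrix (Fin m) (Fin n) A) : (Fin n → A) →ₗ[k⟦X⟧] (Fin m → A) where
  toFun x := D *ᵥ x
  map_add' x y := mulVec_add D x y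
  map_smul' c x := mulVec_smul D c x

@[simp] theorem rowMap_apply {m n : ℕ} (D : Matrix (Fin m) (Fin n) A) (x : Fin m → A) :
    rowMap k D x = x ᵥ* D := rfl

@[simp] theorem colMap_apply {m n : ℕ} (D : Matrix (Fin m) (Fin n) A) (x : Fin n → A) :
    colMap k D x = D *ᵥ x := rfl

theorem comp_vecMul {R S : Type*} [Ring R] [Ring S] (f : R →+* S) {m n : ℕ}
    (D : Matrix (Fin m) (Fin n) R) (x : Fin m → R) : f ∘ (x ᵥ* D) = (f ∘ x) ᵥ* D.map f :=
  funext fun i => f.map_vecMul D x i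

theorem comp_mulVec {R S : Type*} [Ring R] [Ring S] (f : R →+* S) {m n : ℕ}
    (D : Matrix (Fin m) (Fin n) R) (x : Fin n → R) : f ∘ (D *ᵥ x) = D.map f *ᵥ (f ∘ x) :=
  funext fun i => f.map_mulVec D x i

theorem prevMatrix_map {R S : Type u} [Ring R] [Ring S] (f : R →+* S) {n : ℕ → ℕ}
    (D : ∀ i, Matrix (Fin (n (i + 1))) (Fin (n i)) R) (i : ℕ) :
    prevMatrix (fun i => (D i).map f) i = (prevMatrix D i).map f := by
  cases i with
  | zero =>
    ext a b
    exact b.elim0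
  | succ i => rfl

theorem IsFreeResolution.mul_prevMatrix {R : Type u} [Ring R] {n : ℕ → ℕ}
    {D : ∀ i, Matrix (Fin (n (i + 1))) (Fin (n i)) R} {M : ModuleCat.{u} R}
    {aug : (Fin (n 0) → R) →ₗ[R] M} (h : IsFreeResolution D aug) (i : ℕ) :
    D i * prevMatrix D i = 0 := by
  cases i with
  | zero =>
    ext a b
    exact b.elim0
  | succ i => exact h.mul_eq_zero i

/-- The map `x ↦ ∑ ε(xᵢ) cᵢ`. -/
def charSum {R S : Type u} [Ring R] [Ring S] (ε : R →+* S) {m : ℕ} (c : Fin m → S) :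
    (Fin m → R) →+ S where
  toFun x := ∑ i, ε (x i) * c i
  map_zero' := by simp
  map_add' x y := by simp [add_mul, Finset.sum_add_distrib]

theorem charSum_apply {R S : Type u} [Ring R] [Ring S] (ε : R →+* S) {m : ℕ} (c : Fin m → S)
    (x : Fin m → R) : charSum ε c x = ∑ i, ε (x i) * c i := rfl

/-- The map `x ↦ ∑ ε(xᵢ) cᵢ` to the module that a character `ε` defines. -/
def charAug {R S : Type u} [Ring R] [Ring S] (ε : R →+* S) {m : ℕ} (c : Fin m → S) :
    (Fin m → R) →ₗ[R] moduleOfChar ε where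
  toFun := charSum ε c
  map_add' := map_add (charSum ε c)
  map_smul' r x := by
    change charSum ε c (r • x) = ε r * charSum ε c x
    simp [charSum_apply, Finset.mul_sum, mul_assoc]

theorem charSum_smul (ε : A →ₐ[k⟦X⟧] k⟦X⟧) {m : ℕ} (c : Fin m → k⟦X⟧) (r : k⟦X⟧)
    (x : Fin m → A) : charSum (ε : A →+* k⟦X⟧) c (r • x) = r * charSum (ε : A →+* k⟦X⟧) c x := by
  simp [charSum_apply, Finset.mul_sum, mul_assoc]

end Matrices

/-! ### Reduction modulo `h` -/

namespace Reduction

open Matrix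

variable {k A A₀ : Type u} [Field k] [Ring A] [Algebra k⟦X⟧ A] [Ring A₀] [Algebra k A₀]
  (π : Reduction k A A₀)

theorem proj_X_smul (a : A) : π.proj ((PowerSeries.X : k⟦X⟧) • a) = 0 :=
  (π.proj_eq_zero_iff _).mpr ⟨a, rfl⟩

theorem comp_X_smul {n : ℕ} (x : Fin n → A) : π.proj ∘ ((PowerSeries.X : k⟦X⟧) • x) = 0 :=
  funext fun i => π.proj_X_smul (x i)

theorem comp_add {n : ℕ} (x y : Fin n → A) : π.proj ∘ (x + y) = π.proj ∘ x + π.proj ∘ y :=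
  funext fun i => map_add π.proj (x i) (y i)

theorem comp_eq_iff {n : ℕ} (x y : Fin n → A) :
    π.proj ∘ x = π.proj ∘ y ↔ ∃ z, x = y + (PowerSeries.X : k⟦X⟧) • z := by
  constructor
  · intro h
    have (i : Fin n) : ∃ z, x i - y i = (PowerSeries.X : k⟦X⟧) • z :=
      (π.proj_eq_zero_iff _).mp (by rw [map_sub, sub_eq_zero]; exact congrFun h i)
    choose z hz using this
    refine ⟨z, funext fun i => ?_⟩
    rw [Pi.add_apply, Pi.smul_apply, ← hz]
    abel
  · rintro ⟨z, rfl⟩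
    rw [comp_add, comp_X_smul, add_zero]

theorem comp_surjective {n : ℕ} (x : Fin n → A₀) : ∃ y : Fin n → A, π.proj ∘ y = x := by
  choose y hy using fun i => π.surjective (x i)
  exact ⟨y, funext hy⟩

/-- A submodule of `Aᵐ` without `h`-torsion in the quotient is finitely generated if `A / hA` is
noetherian. -/
theorem exists_matrix_of_saturated (π : Reduction k A A₀) [IsNoetherianRing A₀]
    [IsAdicComplete (hIdeal k) A] {m : ℕ}
    (N : Submodule A (Fin m → A)) (hN : ∀ x, (PowerSeries.X : k⟦X⟧) • x ∈ N → x ∈ N) :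
    ∃ (r : ℕ) (D : Matrix (Fin r) (Fin m) A), ∀ x, x ∈ N ↔ ∃ y, y ᵥ* D = x := by
  -- The image of `N` modulo `h` is finitely generated; generators of it are lifted to elements of
  -- `N`.
  let N₀ : Submodule A₀ (Fin m → A₀) :=
    { carrier := {x | ∃ y ∈ N, π.proj ∘ y = x}
      add_mem' := by
        rintro _ _ ⟨x, hx, rfl⟩ ⟨y, hy, rfl⟩
        exact ⟨x + y, N.add_mem hx hy, π.comp_add x y⟩
      zero_mem' := ⟨0, N.zero_mem, funext fun i => map_zero π.proj⟩
      smul_mem' := by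
        rintro c _ ⟨x, hx, rfl⟩
        obtain ⟨c, rfl⟩ := π.surjective c
        exact ⟨c • x, N.smul_mem c hx, funext fun i => map_mul π.proj c (x i)⟩ }
  obtain ⟨r, g, hg⟩ := Submodule.fg_iff_exists_fin_generating_family.mp
    (IsNoetherian.noetherian N₀)
  have (i : Fin r) : ∃ y ∈ N, π.proj ∘ y = g i := by
    change g i ∈ N₀
    rw [← hg]
    exact Submodule.subset_span ⟨i, rfl⟩
  choose D hD hDg using this
  have hrange (y : Fin r → A) : y ᵥ* (Matrix.of D) ∈ N := by
    rw [vecMul_eq_sum]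
    exact N.sum_mem fun i _ => N.smul_mem _ (hD i)
  refine ⟨r, Matrix.of D, fun x => ⟨fun hx => ?_, ?_⟩⟩
  · refine exists_eq_of_approx (rowMap k (Matrix.of D)) (· ∈ N) (fun y hy => ?_) x hx
    have hy₀ : π.proj ∘ y ∈ Submodule.span A₀ (Set.range g) := by
      rw [hg]
      exact ⟨y, hy, rfl⟩
    obtain ⟨c, hc⟩ := (Submodule.mem_span_range_iff_exists_fun A₀).mp hy₀
    obtain ⟨a, rfl⟩ := π.comp_surjective c
    have h1 : π.proj ∘ y = π.proj ∘ (a ᵥ* Matrix.of D) := by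
      rw [comp_vecMul, vecMul_eq_sum, ← hc]
      refine Finset.sum_congr rfl fun i _ => ?_
      rw [← hDg]
      rfl
    obtain ⟨z, hz⟩ := (π.comp_eq_iff _ _).mp h1
    -- The difference `h z` lies in `N`, so `z` does by saturation, and the approximation continues
    -- inside `N`.
    refine ⟨a, z, hN _ ?_, hz⟩
    rw [← sub_eq_iff_eq_add'.mpr hz]
    exact N.sub_mem hy (hrange a)
  · rintro ⟨y, rfl⟩
    exact hrange y

/-- A character of a complete torsion-free algebra with noetherian reduction has a resolution by
finite free modules. -/
theorem exists_freeResolution (π : Reduction k A A₀) [IsNoetherianRing A₀]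
    [IsAdicComplete (hIdeal k) A] [HTorsionFree k A] (ε : A →ₐ[k⟦X⟧] k⟦X⟧) :
    ∃ (n : ℕ → ℕ) (D : ∀ i, Matrix (Fin (n (i + 1))) (Fin (n i)) A) (c : Fin (n 0) → k⟦X⟧),
      IsFreeResolution D (charAug (ε : A →+* k⟦X⟧) c) := by
  have step (t : Σ (m n : ℕ), Matrix (Fin m) (Fin n) A) :
      ∃ (r : ℕ) (E : Matrix (Fin r) (Fin t.1) A), ∀ x, x ᵥ* t.2.2 = 0 ↔ ∃ y, y ᵥ* E = x :=
    π.exists_matrix_of_saturated (LinearMap.ker (Matrix.vecMulLinear t.2.2)) fun x hx =>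
      HTorsionFree.eq_zero (k := k) _
        ((smul_vecMul (PowerSeries.X : k⟦X⟧) x t.2.2).symm.trans (LinearMap.mem_ker.mp hx))
  choose r E hE using step
  obtain ⟨r₀, D₀, h₀⟩ := π.exists_matrix_of_saturated
    (LinearMap.ker (charAug (ε : A →+* k⟦X⟧) (fun _ : Fin 1 => 1))) fun x hx => by
      have hx' : charSum (ε : A →+* k⟦X⟧) (fun _ => 1) ((PowerSeries.X : k⟦X⟧) • x) = 0 := hx
      rw [charSum_smul] at hx'
      exact HTorsionFree.eq_zero (k := k) (M := k⟦X⟧) _ hx'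
  -- Each term is a matrix with its numbers of rows and columns; the rows of the next matrix
  -- generate its left kernel, which is saturated because `A` has no torsion.
  let seq : ℕ → Σ (m n : ℕ), Matrix (Fin m) (Fin n) A :=
    fun i => Nat.rec ⟨r₀, 1, D₀⟩ (fun _ t => ⟨r t, t.1, E t⟩) i
  refine ⟨fun i => (seq i).2.1, fun i => (seq i).2.2, fun _ => 1, ⟨?_, ?_, ?_⟩⟩
  · intro s
    refine ⟨fun _ => algebraMap k⟦X⟧ A s, ?_⟩
    change (∑ i : Fin 1, _ : k⟦X⟧) = _
    simp only [Fin.sum_univ_one, mul_one]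
    exact ε.commutes s
  · exact h₀
  · exact fun i => hE (seq i)

/-- The reduction modulo `h` of a free resolution of a character is a free resolution. -/
theorem isFreeResolution_map [HTorsionFree k A] (ε : A →ₐ[k⟦X⟧] k⟦X⟧) (ε₀ : A₀ →ₐ[k] k)
    (hε : ∀ a : A, ε₀ (π.proj a) = PowerSeries.constantCoeff (ε a)) {n : ℕ → ℕ}
    {D : ∀ i, Matrix (Fin (n (i + 1))) (Fin (n i)) A} {c : Fin (n 0) → k⟦X⟧}
    (h : IsFreeResolution D (charAug (ε : A →+* k⟦X⟧) c)) :
    IsFreeResolution (fun i => (D i).map π.proj)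
      (charAug (ε₀ : A₀ →+* k) (PowerSeries.constantCoeff ∘ c)) := by
  have haug (x : Fin (n 0) → A) : charSum (ε₀ : A₀ →+* k) (PowerSeries.constantCoeff ∘ c)
      (π.proj ∘ x) = PowerSeries.constantCoeff (charSum (ε : A →+* k⟦X⟧) c x) := by
    rw [charSum_apply, charSum_apply, map_sum]
    refine Finset.sum_congr rfl fun i _ => ?_
    rw [map_mul]
    exact congrArg (· * _) (hε (x i))
  have hexact (x : Fin (n 0) → A) : charSum (ε : A →+* k⟦X⟧) c x = 0 ↔ ∃ y, y ᵥ* D 0 = x :=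
    h.exact_aug x
  constructor
  · intro (s : k)
    obtain ⟨x, hx⟩ := h.surjective (PowerSeries.C s : k⟦X⟧)
    refine ⟨π.proj ∘ x, (haug x).trans ?_⟩
    exact (congrArg PowerSeries.constantCoeff hx).trans (PowerSeries.constantCoeff_C s)
  · intro x
    obtain ⟨x, rfl⟩ := π.comp_surjective x
    refine Iff.trans (Eq.congr_left (haug x)) ?_
    constructor
    · intro (hx : PowerSeries.constantCoeff (charSum (ε : A →+* k⟦X⟧) c x) = (0 : k))
      obtain ⟨s, hs⟩ := PowerSeries.X_dvd_iff.mpr hx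
      -- The augmentation of `x` is `h s`; subtracting `h w` does not change `x` modulo `h` and
      -- makes it an exact cycle.
      obtain ⟨w, hw⟩ := h.surjective s
      replace hw : charSum (ε : A →+* k⟦X⟧) c w = s := hw
      obtain ⟨y, hy⟩ := (hexact (x - (PowerSeries.X : k⟦X⟧) • w)).mp (by
        rw [map_sub, charSum_smul, hw, hs, sub_self])
      refine ⟨π.proj ∘ y, ?_⟩
      rw [← comp_vecMul, hy]
      exact ((π.comp_eq_iff _ _).mpr ⟨w, by abel⟩).symm
    · rintro ⟨y, hy⟩
      obtain ⟨y, rfl⟩ := π.comp_surjective y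
      rw [← comp_vecMul] at hy
      rw [← haug, ← hy, haug, (hexact _).mpr ⟨y, rfl⟩, map_zero]
      rfl
  · intro i x
    obtain ⟨x, rfl⟩ := π.comp_surjective x
    rw [← comp_vecMul]
    constructor
    · intro hx
      obtain ⟨z, hz⟩ := (π.comp_eq_iff (x ᵥ* D i) 0).mp
        (hx.trans (funext fun j => (map_zero π.proj).symm))
      rw [zero_add] at hz
      -- The next map of the complex kills `h z = x ᵥ* D i`, hence kills `z`, as its target has no
      -- torsion. So `z` is a boundary, and `x` can be corrected by `h w` to a cycle. For `i = 0`
      -- the next map is the augmentation.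
      have hz0 : ∃ w, w ᵥ* D i = z := by
        cases i with
        | zero =>
          refine (hexact z).mp (HTorsionFree.eq_zero (k := k) (M := k⟦X⟧) _ ?_)
          rw [smul_eq_mul, ← charSum_smul, ← hz]
          exact (hexact _).mpr ⟨x, rfl⟩
        | succ i =>
          refine (h.exact i z).mp (HTorsionFree.eq_zero (k := k) _ ?_)
          rw [← smul_vecMul, ← hz]
          exact (h.exact i _).mpr ⟨x, rfl⟩
      obtain ⟨w, rfl⟩ := hz0
      have h2 : (x - (PowerSeries.X : k⟦X⟧) • w) ᵥ* D i = 0 := by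
        rw [sub_vecMul, smul_vecMul, hz, sub_self]
      obtain ⟨y, hy⟩ := (h.exact i _).mp h2
      refine ⟨π.proj ∘ y, ?_⟩
      rw [← comp_vecMul, hy]
      exact ((π.comp_eq_iff _ _).mpr ⟨w, by abel⟩).symm
    · rintro ⟨y, hy⟩
      obtain ⟨y, rfl⟩ := π.comp_surjective y
      rw [← comp_vecMul] at hy
      obtain ⟨z, rfl⟩ := (π.comp_eq_iff _ _).mp hy.symm
      rw [add_vecMul, (h.exact i _).mpr ⟨y, rfl⟩, zero_add, smul_vecMul, comp_X_smul]

end Reduction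

/-! ### The resolution of `A` over its enveloping algebra -/

section RowSplitting

open Matrix

variable {k A : Type u} [Field k] [Ring A] [Algebra k⟦X⟧ A]

/-- The `k⟦h⟧`-linear map `x ↦ ∑ ε(xᵢ) cᵢ`. -/
def counitMap (ε : A →ₐ[k⟦X⟧] k⟦X⟧) {m : ℕ} (c : Fin m → k⟦X⟧) :
    (Fin m → A) →ₗ[k⟦X⟧] k⟦X⟧ where
  toFun := charSum (ε : A →+* k⟦X⟧) c
  map_add' := map_add _
  map_smul' r x := charSum_smul ε c r x

theorem counitMap_apply (ε : A →ₐ[k⟦X⟧] k⟦X⟧) {m : ℕ} (c : Fin m → k⟦X⟧) (x : Fin m → A) :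
    counitMap ε c x = ∑ i, ε (x i) * c i := rfl

namespace IsFreeResolution

variable {ε : A →ₐ[k⟦X⟧] k⟦X⟧} {n : ℕ → ℕ}
  {D : ∀ i, Matrix (Fin (n (i + 1))) (Fin (n i)) A} {c : Fin (n 0) → k⟦X⟧}

theorem counitMap_eq_zero_iff (h : IsFreeResolution D (charAug (ε : A →+* k⟦X⟧) c))
    (x : Fin (n 0) → A) : counitMap ε c x = 0 ↔ ∃ y, rowMap k (D 0) y = x :=
  h.exact_aug x

theorem counitMap_surjective (h : IsFreeResolution D (charAug (ε : A →+* k⟦X⟧) c)) :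
    Function.Surjective (counitMap ε c) :=
  h.surjective

variable [IsAdicComplete (hIdeal k) A] [HTorsionFree k A]

/-- By exactness the image of a differential is the kernel of the next map, whose target is
separated and torsion-free. -/
theorem exists_rowMap_inverse (h : IsFreeResolution D (charAug (ε : A →+* k⟦X⟧) c)) (i : ℕ) :
    ∃ t, rowMap k (D i) ∘ₗ t ∘ₗ rowMap k (D i) = rowMap k (D i) := by
  cases i with
  | zero =>
    exact exists_generalized_inverse _ (counitMap ε c)
      (Submodule.ext fun x => (h.counitMap_eq_zero_iff x).symm)
  | succ i =>
    exact exists_generalized_inverse _ (rowMap k (D i))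
      (Submodule.ext fun x => (h.exact i x).symm)

theorem exists_rowMap_splitting (h : IsFreeResolution D (charAug (ε : A →+* k⟦X⟧) c)) (i : ℕ) :
    ∃ (a : _ →ₗ[k⟦X⟧] _) (b : _ →ₗ[k⟦X⟧] _),
      rowMap k (D (i + 1)) ∘ₗ a + b ∘ₗ rowMap k (D i) = LinearMap.id :=
  exists_splitting (fun x hx => (h.exact i x).mp hx) (h.exists_rowMap_inverse (i + 1))
    (h.exists_rowMap_inverse i)

theorem exists_counitMap_splitting (h : IsFreeResolution D (charAug (ε : A →+* k⟦X⟧) c)) :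
    ∃ (a : _ →ₗ[k⟦X⟧] _) (b : _ →ₗ[k⟦X⟧] _),
      rowMap k (D 0) ∘ₗ a + b ∘ₗ counitMap ε c = LinearMap.id :=
  exists_splitting (fun x hx => (h.counitMap_eq_zero_iff x).mp hx) (h.exists_rowMap_inverse 0)
    -- The augmentation is onto, so its image is the kernel of the zero map of `K`.
    (exists_generalized_inverse _ (0 : k⟦X⟧ →ₗ[k⟦X⟧] k⟦X⟧) (by
      rw [LinearMap.ker_zero, LinearMap.range_eq_top]
      exact h.counitMap_surjective))

end IsFreeResolution

end RowSplitting

/-- The isomorphism `K ⊗̂ M ≃ M` for a complete module `M`. -/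
def CTensor.lidEquiv (k M : Type u) [Field k] [AddCommGroup M] [Module k⟦X⟧ M]
    [IsAdicComplete (hIdeal k) M] : CTensor k k⟦X⟧ M ≃ₗ[k⟦X⟧] M :=
  LinearEquiv.ofLinearMap (CTensor.lift (LinearMap.lsmul k⟦X⟧ M)) (CTensor.mk 1)
    (LinearMap.ext fun m => by simp)
    (CTensor.hom_ext fun r m => by
      simp only [LinearMap.comp_apply, CTensor.lift_mk, LinearMap.lsmul_apply, LinearMap.id_apply,
        map_smul]
      rw [← LinearMap.smul_apply, ← map_smul, smul_eq_mul, mul_one])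

@[simp] theorem CTensor.lidEquiv_mk (k M : Type u) [Field k] [AddCommGroup M] [Module k⟦X⟧ M]
    [IsAdicComplete (hIdeal k) M] (r : k⟦X⟧) (m : M) :
    CTensor.lidEquiv k M (CTensor.mk r m) = r • m := by
  simp [CTensor.lidEquiv]

namespace TopHopf

open Matrix

variable {k A : Type u} [Field k] [Ring A] [Algebra k⟦X⟧ A] [IsAdicComplete (hIdeal k) A]
  (H : TopHopf k A)

/-- The isomorphism `Aⁿ ⊗̂ A ≃ (A ⊗̂ Aᵒᵖ)ⁿ` with `x ⊗ y ↦ ((1 ⊗ y) δ(xᵢ))ᵢ`. -/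
def rowUntwist (n : ℕ) : CTensor k (Fin n → A) A ≃ₗ[k⟦X⟧] (Fin n → Env k A) :=
  (CTensor.piEquiv k A A n).trans (LinearEquiv.piCongrRight fun _ => H.rightUntwist)

theorem rowUntwist_mk (n : ℕ) (x : Fin n → A) (y : A) (i : Fin n) :
    H.rowUntwist n (CTensor.mk x y) i =
      CTensor.mk (k := k) 1 (MulOpposite.op y) * H.delta (x i) := by
  change H.rightUntwist (CTensor.piEquiv k A A n (CTensor.mk x y) i) = _
  rw [CTensor.piEquiv_mk, rightUntwist_mk]

set_option synthInstance.maxHeartbeats 400000 in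
-- Multiplicativity of `δ` turns the action of `D` on `x` into the action of `δ(D)` on `(1 ⊗ y)
-- δ(x)`.
theorem rowUntwist_map {m n : ℕ} (D : Matrix (Fin m) (Fin n) A) (t : CTensor k (Fin m → A) A) :
    H.rowUntwist n (CTensor.map (rowMap k D) LinearMap.id t) =
      H.rowUntwist m t ᵥ* D.map (H.delta : A →+* Env k A) := by
  have : (H.rowUntwist n).toLinearMap ∘ₗ CTensor.map (rowMap k D) LinearMap.id =
      rowMap k (D.map (H.delta : A →+* Env k A)) ∘ₗ (H.rowUntwist m).toLinearMap :=
    CTensor.hom_ext fun x y => funext fun j => by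
      simp only [LinearMap.comp_apply, CTensor.map_mk, LinearMap.id_apply, LinearEquiv.coe_coe,
        rowUntwist_mk, rowMap_apply, vecMul, dotProduct, map_sum, map_mul, Finset.mul_sum,
        ← mul_assoc]
      rfl
  exact LinearMap.congr_fun this t

/-- The augmentation `z ↦ ∑ zᵢ • cᵢ` of the resolution of `A` over `A ⊗̂ Aᵒᵖ`. -/
def envAug (A : Type u) [Ring A] [Algebra k⟦X⟧ A] [IsAdicComplete (hIdeal k) A]
    {m : ℕ} (c : Fin m → k⟦X⟧) : (Fin m → Env k A) →ₗ[Env k A] ModuleCat.of (Env k A) A where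
  toFun z := (∑ i, z i • algebraMap k⟦X⟧ A (c i) : A)
  map_add' z w := by
    change (∑ i, (z i + w i) • algebraMap k⟦X⟧ A (c i) : A) =
      (∑ i, z i • algebraMap k⟦X⟧ A (c i) : A) + (∑ i, w i • algebraMap k⟦X⟧ A (c i) : A)
    simp only [add_smul, Finset.sum_add_distrib]
  map_smul' z w := by
    change (∑ i, (z * w i) • algebraMap k⟦X⟧ A (c i) : A) =
      z • (∑ i, w i • algebraMap k⟦X⟧ A (c i) : A)
    simp only [mul_smul, Finset.smul_sum]

/-- On `x ⊗ y` both sides are `∑ ε(xᵢ) cᵢ y`, because `δ(a) • 1 = ε(a)`. -/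
theorem envAug_rowUntwist {m : ℕ} (c : Fin m → k⟦X⟧) (t : CTensor k (Fin m → A) A) :
    (envAug A c (H.rowUntwist m t) : A) =
      CTensor.lidEquiv k A (CTensor.map (counitMap H.counit c) LinearMap.id t) := by
  let f : (Fin m → Env k A) →ₗ[k⟦X⟧] A :=
    ∑ i, (envAct k A).flip (algebraMap k⟦X⟧ A (c i)) ∘ₗ LinearMap.proj i
  have hf (z : Fin m → Env k A) : f z = envAug A c z := by
    simp only [f, LinearMap.sum_apply]
    rfl
  have h1 (a y : A) (r : k⟦X⟧) : envAct k A (CTensor.mk (k := k) 1 (MulOpposite.op y) * H.delta a)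
      (algebraMap k⟦X⟧ A r) = (H.counit a * r) • y := by
    have h2 : envAct k A (H.delta a) 1 = algebraMap k⟦X⟧ A (H.counit a) := H.delta_smul_one a
    rw [envAct_mul, Algebra.algebraMap_eq_smul_one, map_smul, h2, envAct_mk, one_mul,
      MulOpposite.unop_op, smul_mul_assoc, ← Algebra.smul_def, smul_smul, mul_comm]
  have : f ∘ₗ (H.rowUntwist m).toLinearMap = (CTensor.lidEquiv k A).toLinearMap ∘ₗ
      CTensor.map (counitMap H.counit c) LinearMap.id :=
    CTensor.hom_ext fun x y => by
      simp only [LinearMap.comp_apply, CTensor.map_mk, LinearMap.id_apply, LinearEquiv.coe_coe,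
        CTensor.lidEquiv_mk, counitMap_apply, f, LinearMap.sum_apply, LinearMap.proj_apply,
        LinearMap.flip_apply, rowUntwist_mk, h1, Finset.sum_smul]
  rw [← hf]
  exact LinearMap.congr_fun this t

/-- The homomorphism `δ` transforms a free resolution of the trivial module over `A` into a free
resolution of `A` over `A ⊗̂ Aᵒᵖ`. -/
theorem isFreeResolution_env [HTorsionFree k A] {n : ℕ → ℕ}
    {D : ∀ i, Matrix (Fin (n (i + 1))) (Fin (n i)) A} {c : Fin (n 0) → k⟦X⟧}
    (h : IsFreeResolution D (charAug (H.counit : A →+* k⟦X⟧) c)) :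
    IsFreeResolution (fun i => (D i).map (H.delta : A →+* Env k A)) (envAug A c) := by
  constructor
  · intro (a : A)
    obtain ⟨x, hx⟩ := h.counitMap_surjective 1
    refine ⟨H.rowUntwist _ (CTensor.mk x a), ?_⟩
    refine (H.envAug_rowUntwist c _).trans ?_
    rw [CTensor.map_mk, hx, CTensor.lidEquiv_mk, one_smul]
    rfl
  · intro z
    obtain ⟨t, rfl⟩ := (H.rowUntwist _).surjective z
    refine Iff.trans (Eq.congr_left (H.envAug_rowUntwist c t)) ?_
    refine Iff.trans (CTensor.lidEquiv k A).map_eq_zero_iff ?_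
    constructor
    · intro ht
      obtain ⟨s, rfl⟩ := CTensor.exists_map_eq h.exists_counitMap_splitting t ht
      exact ⟨H.rowUntwist _ s, (H.rowUntwist_map _ _).symm⟩
    · rintro ⟨y, hy⟩
      obtain ⟨s, rfl⟩ := (H.rowUntwist _).surjective y
      rw [← rowUntwist_map] at hy
      rw [← (H.rowUntwist _).injective hy, ← LinearMap.comp_apply, ← CTensor.map_comp]
      have : counitMap H.counit c ∘ₗ rowMap k (D 0) = 0 :=
        LinearMap.ext fun x => (h.counitMap_eq_zero_iff _).mpr ⟨x, rfl⟩
      rw [this, CTensor.map_zero_left, LinearMap.zero_apply]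
  · intro i z
    obtain ⟨t, rfl⟩ := (H.rowUntwist _).surjective z
    rw [← rowUntwist_map, LinearEquiv.map_eq_zero_iff]
    constructor
    · intro ht
      obtain ⟨s, rfl⟩ := CTensor.exists_map_eq (h.exists_rowMap_splitting i) t ht
      exact ⟨H.rowUntwist _ s, (H.rowUntwist_map _ _).symm⟩
    · rintro ⟨y, hy⟩
      obtain ⟨s, rfl⟩ := (H.rowUntwist _).surjective y
      rw [← rowUntwist_map] at hy
      rw [← (H.rowUntwist _).injective hy, ← LinearMap.comp_apply, ← CTensor.map_comp]
      have : rowMap k (D i) ∘ₗ rowMap k (D (i + 1)) = 0 :=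
        LinearMap.ext fun x => (h.exact i _).mpr ⟨x, rfl⟩
      rw [this, CTensor.map_zero_left, LinearMap.zero_apply]

end TopHopf

/-! ### The dual complex -/

section DualComplex

open Matrix

variable {k : Type u} [Field k]

section Prod

variable {M N : Type u} [AddCommGroup M] [Module k⟦X⟧ M] [AddCommGroup N] [Module k⟦X⟧ N]

instance [IsPrecomplete (hIdeal k) M] [IsPrecomplete (hIdeal k) N] :
    IsPrecomplete (hIdeal k) (M × N) where
  prec' f hf := by
    simp only [SModEq.sub_mem, mem_pow_smul_top_iff] at hf
    obtain ⟨x, hx⟩ := IsPrecomplete.prec (I := hIdeal k) (M := M) ‹_› (f := fun i => (f i).1)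
      fun {m n} hmn => by
        rw [SModEq.sub_mem, mem_pow_smul_top_iff]
        obtain ⟨y, hy⟩ := hf hmn
        exact ⟨y.1, congrArg Prod.fst hy⟩
    obtain ⟨y, hy⟩ := IsPrecomplete.prec (I := hIdeal k) (M := N) ‹_› (f := fun i => (f i).2)
      fun {m n} hmn => by
        rw [SModEq.sub_mem, mem_pow_smul_top_iff]
        obtain ⟨y, hy⟩ := hf hmn
        exact ⟨y.2, congrArg Prod.snd hy⟩
    refine ⟨(x, y), fun n => ?_⟩
    simp only [SModEq.sub_mem, mem_pow_smul_top_iff] at hx hy ⊢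
    obtain ⟨a, ha⟩ := hx n
    obtain ⟨b, hb⟩ := hy n
    exact ⟨(a, b), Prod.ext ha hb⟩

instance [IsHausdorff (hIdeal k) M] [IsHausdorff (hIdeal k) N] :
    IsHausdorff (hIdeal k) (M × N) := by
  rw [isHausdorff_iff_forall]
  intro x hx
  refine Prod.ext (IsHausdorff.eq_zero_of_forall (k := k) _ fun n => ?_)
    (IsHausdorff.eq_zero_of_forall (k := k) _ fun n => ?_)
  · obtain ⟨y, rfl⟩ := hx n
    exact ⟨y.1, rfl⟩
  · obtain ⟨y, rfl⟩ := hx n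
    exact ⟨y.2, rfl⟩

instance [HTorsionFree k M] [HTorsionFree k N] : HTorsionFree k (M × N) :=
  ⟨fun _ hx => Prod.ext (HTorsionFree.eq_zero (k := k) _ (congrArg Prod.fst hx))
    (HTorsionFree.eq_zero (k := k) _ (congrArg Prod.snd hx))⟩

end Prod

variable {A A₀ : Type u} [Ring A] [Algebra k⟦X⟧ A] [Ring A₀] [Algebra k A₀]
  (π : Reduction k A A₀)

theorem Reduction.comp_smul {n : ℕ} (s : k⟦X⟧) (x : Fin n → A) :
    π.proj ∘ (s • x) = fun j => π.proj (x j) * algebraMap k A₀ (PowerSeries.constantCoeff s) := by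
  funext j
  obtain ⟨r, hr⟩ : ∃ r, s - PowerSeries.C (PowerSeries.constantCoeff s) = PowerSeries.X * r :=
    PowerSeries.X_dvd_iff.mpr (by simp)
  have : s = PowerSeries.C (PowerSeries.constantCoeff s) + PowerSeries.X * r := by
    rw [← hr]
    ring
  conv_lhs => rw [this]
  rw [Function.comp_apply, Pi.smul_apply, add_smul, mul_smul, map_add, π.proj_X_smul, add_zero,
    Algebra.smul_def, ← Algebra.commutes, map_mul, π.proj_algebraMap]

/-- The dual of a complex of finite free `A`-modules whose reduction modulo `h` has cohomology only
in degree `d`, where it is the line spanned by the class of `ω₀`. -/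
structure IsDualityComplex {n : ℕ → ℕ} (D : ∀ i, Matrix (Fin (n (i + 1))) (Fin (n i)) A) (d : ℕ)
    (ω₀ : Fin (n d) → A₀) : Prop where
  mul_prevMatrix : ∀ i, D i * prevMatrix D i = 0
  exact : ∀ i, i ≠ d → ∀ y, (D i).map π.proj *ᵥ y = 0 →
    ∃ z, (prevMatrix D i).map π.proj *ᵥ z = y
  cocycle : (D d).map π.proj *ᵥ ω₀ = 0
  exists_eq : ∀ y, (D d).map π.proj *ᵥ y = 0 → ∃ (z : _) (s : k),
    y = (prevMatrix D d).map π.proj *ᵥ z + fun j => ω₀ j * algebraMap k A₀ s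
  not_boundary : ∀ z, (prevMatrix D d).map π.proj *ᵥ z ≠ ω₀

namespace IsDualityComplex

variable {π} {n : ℕ → ℕ} {D : ∀ i, Matrix (Fin (n (i + 1))) (Fin (n i)) A} {d : ℕ}
  {ω₀ : Fin (n d) → A₀}

theorem mulVec_prevMatrix_mulVec (h : IsDualityComplex π D d ω₀) (i : ℕ)
    (z : Fin (prevRank n i) → A) : D i *ᵥ (prevMatrix D i *ᵥ z) = 0 := by
  rw [mulVec_mulVec, h.mul_prevMatrix, zero_mulVec]

/-- Modulo `h`, `z` is a cocycle of degree `d - 1`, where the reduced cohomology vanishes. So `z` is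
a boundary plus `h z'`, and the differential kills the boundary. For `d = 0` the incoming
differential is zero. -/
theorem exists_smul_eq (h : IsDualityComplex π D d ω₀) (z : Fin (prevRank n d) → A)
    (hz : (prevMatrix D d).map π.proj *ᵥ (π.proj ∘ z) = 0) :
    ∃ z', prevMatrix D d *ᵥ z = (PowerSeries.X : k⟦X⟧) • prevMatrix D d *ᵥ z' := by
  cases d with
  | zero => exact ⟨0, by rw [mulVec_zero, smul_zero]; exact zero_mulVec z⟩
  | succ d =>
    change Fin (n d) → A at z
    obtain ⟨w, hw⟩ := h.exact d (Nat.succ_ne_self d).symm (π.proj ∘ z) hz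
    obtain ⟨w, rfl⟩ := π.comp_surjective w
    rw [← comp_mulVec] at hw
    obtain ⟨v, rfl⟩ := (π.comp_eq_iff _ _).mp hw.symm
    refine ⟨v, ?_⟩
    change D d *ᵥ _ = (PowerSeries.X : k⟦X⟧) • D d *ᵥ v
    rw [mulVec_add, mulVec_smul, h.mulVec_prevMatrix_mulVec, zero_add]

variable [HTorsionFree k A]

/-- The class of `ω` has no annihilator in `K`. If `s ω` is a boundary, then `s` has no constant
term because `ω₀` is not a boundary; `exists_smul_eq` allows division by `h`, and iteration makes
`s` divisible by every power of `h`. -/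
theorem eq_zero_of_boundary (h : IsDualityComplex π D d ω₀) {ω : Fin (n d) → A}
    (hω₀ : π.proj ∘ ω = ω₀) (z : Fin (prevRank n d) → A) (s : k⟦X⟧)
    (hz : prevMatrix D d *ᵥ z = s • ω) : s = 0 := by
  have step (z : Fin (prevRank n d) → A) (s : k⟦X⟧) (hz : prevMatrix D d *ᵥ z = s • ω) :
      ∃ z' s', s = PowerSeries.X * s' ∧ prevMatrix D d *ᵥ z' = s' • ω := by
    have h1 : (prevMatrix D d).map π.proj *ᵥ (π.proj ∘ z) =
        fun j => ω₀ j * algebraMap k A₀ (PowerSeries.constantCoeff s) := by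
      rw [← comp_mulVec, hz, π.comp_smul, ← hω₀]
      rfl
    have h2 : PowerSeries.constantCoeff s = 0 := by
      by_contra hs
      -- A nonzero constant term could be inverted in `k`, and the rescaled `z` would bound `ω₀`.
      refine h.not_boundary
        (fun j => π.proj (z j) * algebraMap k A₀ (PowerSeries.constantCoeff s)⁻¹) ?_
      funext i
      have h3 := congrFun h1 i
      simp only [mulVec, dotProduct, Function.comp_apply] at h3 ⊢
      simp only [← mul_assoc]
      rw [← Finset.sum_mul, h3, mul_assoc, ← map_mul, mul_inv_cancel₀ hs, map_one, mul_one]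
    obtain ⟨s', rfl⟩ := PowerSeries.X_dvd_iff.mpr h2
    obtain ⟨z', hz'⟩ := h.exists_smul_eq z (by
      rw [h1, h2]
      funext j
      simp)
    refine ⟨z', s', rfl, HTorsionFree.cancel (k := k) ?_⟩
    rw [← hz', hz, mul_smul]
  refine IsHausdorff.eq_zero_of_forall (k := k) s fun m => ?_
  suffices ∃ z' s', s = PowerSeries.X ^ m * s' ∧ prevMatrix D d *ᵥ z' = s' • ω from
    let ⟨_, s', hs, _⟩ := this
    ⟨s', hs⟩
  induction m with
  | zero => exact ⟨z, s, by simp, hz⟩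
  | succ m ih =>
    obtain ⟨z', s', rfl, hz'⟩ := ih
    obtain ⟨z'', s'', rfl, hz''⟩ := step z' s' hz'
    exact ⟨z'', s'', by ring, hz''⟩

variable [IsAdicComplete (hIdeal k) A]

/-- A cocycle is a boundary modulo `h`; what remains, divided by `h`, is again a cocycle since there
is no torsion, so successive approximation applies. -/
theorem exists_prevMatrix_mulVec_eq (h : IsDualityComplex π D d ω₀) (i : ℕ) (hi : i ≠ d)
    (y : Fin (n i) → A) (hy : D i *ᵥ y = 0) : ∃ z, prevMatrix D i *ᵥ z = y := by
  refine exists_eq_of_approx (colMap k (prevMatrix D i)) (fun y => D i *ᵥ y = 0)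
    (fun y hy => ?_) y hy
  obtain ⟨z, hz⟩ := h.exact i hi (π.proj ∘ y) (by
    rw [← comp_mulVec, hy]
    exact funext fun _ => map_zero π.proj)
  obtain ⟨z, rfl⟩ := π.comp_surjective z
  rw [← comp_mulVec] at hz
  obtain ⟨w, hw⟩ := (π.comp_eq_iff _ _).mp hz.symm
  refine ⟨z, w, HTorsionFree.eq_zero (k := k) _ ?_, hw⟩
  rw [hw, mulVec_add, h.mulVec_prevMatrix_mulVec, zero_add, mulVec_smul] at hy
  exact hy

/-- Any lift `w` of `ω₀` satisfies `D w = h u`. The obstruction `u` is a cocycle of degree `d + 1`,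
where cohomology already vanishes over `A`; with `u = D v`, the vector `w - h v` is a cocycle that
lifts `ω₀`. -/
theorem exists_cocycle (h : IsDualityComplex π D d ω₀) :
    ∃ ω, D d *ᵥ ω = 0 ∧ π.proj ∘ ω = ω₀ := by
  obtain ⟨w, rfl⟩ := π.comp_surjective ω₀
  have h1 := h.cocycle
  rw [← comp_mulVec] at h1
  obtain ⟨u, hu⟩ := (π.comp_eq_iff (D d *ᵥ w) 0).mp
    (h1.trans (funext fun _ => (map_zero π.proj).symm))
  rw [zero_add] at hu
  have h2 : D (d + 1) *ᵥ u = 0 := by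
    refine HTorsionFree.eq_zero (k := k) _ ?_
    rw [← mulVec_smul, ← hu]
    exact h.mulVec_prevMatrix_mulVec (d + 1) w
  obtain ⟨v, hv⟩ : ∃ v : Fin (n d) → A, D d *ᵥ v = u :=
    h.exists_prevMatrix_mulVec_eq (d + 1) (Nat.succ_ne_self d) u h2
  refine ⟨w - (PowerSeries.X : k⟦X⟧) • v, ?_, (π.comp_eq_iff _ _).mpr ⟨-v, ?_⟩⟩
  · rw [mulVec_sub, mulVec_smul, hu, ← hv]
    exact sub_self _
  · rw [smul_neg, sub_eq_add_neg]

/-- Successive approximation for the boundaries and `K ω` together: modulo `h` they exhaust the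
cocycles, and the remainder is again `h` times a cocycle. -/
theorem exists_eq_add_smul (h : IsDualityComplex π D d ω₀) {ω : Fin (n d) → A}
    (hω : D d *ᵥ ω = 0) (hω₀ : π.proj ∘ ω = ω₀) (y : Fin (n d) → A) (hy : D d *ᵥ y = 0) :
    ∃ (z : _) (s : k⟦X⟧), prevMatrix D d *ᵥ z + s • ω = y := by
  let f : (Fin (prevRank n d) → A) × k⟦X⟧ →ₗ[k⟦X⟧] (Fin (n d) → A) :=
    (colMap k (prevMatrix D d)).coprod (LinearMap.toSpanSingleton k⟦X⟧ _ ω)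
  obtain ⟨x, hx⟩ := exists_eq_of_approx f (fun y => D d *ᵥ y = 0) (fun y hy => by
    obtain ⟨z, s, hz⟩ := h.exists_eq (π.proj ∘ y) (by
      rw [← comp_mulVec, hy]
      exact funext fun _ => map_zero π.proj)
    obtain ⟨z, rfl⟩ := π.comp_surjective z
    have h1 : π.proj ∘ y = π.proj ∘ f (z, PowerSeries.C s) := by
      rw [hz, LinearMap.coprod_apply, π.comp_add, LinearMap.toSpanSingleton_apply, π.comp_smul,
        colMap_apply, comp_mulVec, ← hω₀, PowerSeries.constantCoeff_C]
      rfl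
    obtain ⟨w, hw⟩ := (π.comp_eq_iff _ _).mp h1
    refine ⟨_, w, HTorsionFree.eq_zero (k := k) _ ?_, hw⟩
    rw [hw, LinearMap.coprod_apply, LinearMap.toSpanSingleton_apply, colMap_apply, mulVec_add,
      mulVec_add, h.mulVec_prevMatrix_mulVec, mulVec_smul, hω, smul_zero, zero_add, zero_add,
      mulVec_smul] at hy
    exact hy) y hy
  exact ⟨x.1, x.2, hx⟩

theorem exists_colMap_inverse_of_ne (h : IsDualityComplex π D d ω₀) (i : ℕ) (hi : i ≠ d) :
    ∃ t, colMap k (prevMatrix D i) ∘ₗ t ∘ₗ colMap k (prevMatrix D i) =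
      colMap k (prevMatrix D i) :=
  exists_generalized_inverse _ (colMap k (D i)) (Submodule.ext fun y =>
    ⟨fun ⟨z, hz⟩ => by rw [← hz]; exact h.mulVec_prevMatrix_mulVec i z,
      fun hy => h.exists_prevMatrix_mulVec_eq i hi y hy⟩)

/-- A cocycle `ω` that generates the cohomology, and a splitting of the complex in degree `d`. -/
theorem exists_generator (h : IsDualityComplex π D d ω₀) :
    ∃ (ω : Fin (n d) → A) (p : (Fin (n d) → A) →ₗ[k⟦X⟧] k⟦X⟧) (a : _ →ₗ[k⟦X⟧] _)
      (b : _ →ₗ[k⟦X⟧] _), D d *ᵥ ω = 0 ∧ (∀ z, p (prevMatrix D d *ᵥ z) = 0) ∧ p ω = 1 ∧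
        colMap k (prevMatrix D d) ∘ₗ a + b ∘ₗ colMap k (D d) +
          LinearMap.toSpanSingleton k⟦X⟧ _ ω ∘ₗ p = LinearMap.id ∧
        ∃ t, colMap k (prevMatrix D d) ∘ₗ t ∘ₗ colMap k (prevMatrix D d) =
          colMap k (prevMatrix D d) := by
  obtain ⟨ω, hω, hω₀⟩ := h.exists_cocycle
  -- `D d` is the differential that arrives in degree `d + 1 ≠ d`, so it has a generalized inverse
  -- `t`, and `x - t (D x)` projects onto the cocycles.
  obtain ⟨t, ht⟩ : ∃ t, colMap k (D d) ∘ₗ t ∘ₗ colMap k (D d) = colMap k (D d) :=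
    h.exists_colMap_inverse_of_ne (d + 1) (Nat.succ_ne_self d)
  replace ht (x : Fin (n d) → A) : D d *ᵥ t (D d *ᵥ x) = D d *ᵥ x := LinearMap.congr_fun ht x
  have ht' (x : Fin (n d) → A) : D d *ᵥ (x - t (D d *ᵥ x)) = 0 := by
    rw [mulVec_sub, ht, sub_self]
  -- `P x` is the coordinate along `ω` of the projected cocycle. Its uniqueness, from
  -- `eq_zero_of_boundary`, makes it linear in `x`.
  have hex (x : Fin (n d) → A) : ∃ (s : k⟦X⟧) (z : _),
      prevMatrix D d *ᵥ z + s • ω = x - t (D d *ᵥ x) :=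
    let ⟨z, s, hs⟩ := h.exists_eq_add_smul hω hω₀ _ (ht' x)
    ⟨s, z, hs⟩
  choose P Z hP using hex
  have huniq (x : Fin (n d) → A) (s : k⟦X⟧) (z : Fin (prevRank n d) → A)
      (hz : prevMatrix D d *ᵥ z + s • ω = x - t (D d *ᵥ x)) : P x = s := by
    rw [← sub_eq_zero]
    refine h.eq_zero_of_boundary hω₀ (z - Z x) _ ?_
    rw [mulVec_sub, sub_smul, sub_eq_sub_iff_add_eq_add, hz, ← hP x, add_comm]
  let p : (Fin (n d) → A) →ₗ[k⟦X⟧] k⟦X⟧ :=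
    { toFun := P
      map_add' := fun x y => huniq _ _ (Z x + Z y) (by
        rw [mulVec_add, mulVec_add, map_add, add_smul, add_sub_add_comm, ← hP, ← hP]
        abel)
      map_smul' := fun r x => huniq _ _ (r • Z x) (by
        rw [mulVec_smul, mulVec_smul, map_smul, RingHom.id_apply, smul_eq_mul, mul_smul,
          ← smul_add, hP, smul_sub]) }
  have hpB (z : Fin (prevRank n d) → A) : p (prevMatrix D d *ᵥ z) = 0 :=
    huniq _ _ z (by
      rw [h.mulVec_prevMatrix_mulVec, map_zero, zero_smul, add_zero, sub_zero])
  have hpω : p ω = 1 := huniq _ _ 0 (by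
    rw [hω, map_zero, mulVec_zero, one_smul, zero_add, sub_zero])
  -- The boundaries in degree `d` are the common kernel of the differential and `p`, so the incoming
  -- differential also has a generalized inverse.
  obtain ⟨u, hu⟩ := exists_generalized_inverse (colMap k (prevMatrix D d))
    ((colMap k (D d)).prod p) (Submodule.ext fun y => by
      rw [LinearMap.mem_ker]
      constructor
      · rintro ⟨z, rfl⟩
        exact Prod.ext (h.mulVec_prevMatrix_mulVec d z) (hpB z)
      · intro hy
        have h1 : D d *ᵥ y = 0 := congrArg Prod.fst hy
        have h2 : P y = 0 := congrArg Prod.snd hy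
        have h3 := hP y
        rw [h1, h2, map_zero, zero_smul, add_zero, sub_zero] at h3
        exact ⟨Z y, h3⟩)
  refine ⟨ω, p, u ∘ₗ (LinearMap.id - t ∘ₗ colMap k (D d) -
    LinearMap.toSpanSingleton k⟦X⟧ _ ω ∘ₗ p), t, hω, hpB, hpω, LinearMap.ext fun x => ?_, u, hu⟩
  have h1 : x - t (D d *ᵥ x) - P x • ω = prevMatrix D d *ᵥ Z x := by
    rw [← hP, add_sub_cancel_right]
  have h2 : prevMatrix D d *ᵥ u (prevMatrix D d *ᵥ Z x) = prevMatrix D d *ᵥ Z x :=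
    LinearMap.congr_fun hu (Z x)
  change prevMatrix D d *ᵥ u (x - t (D d *ᵥ x) - P x • ω) + t (D d *ᵥ x) + P x • ω = x
  rw [h1, h2, ← h1]
  abel

/-- The outgoing differential needs a generalized inverse as well. For `i = d - 1` it lands in
degree `d`, where the complex is not exact; there the inverse comes from `exists_generator`. -/
theorem exists_splitting_of_ne (h : IsDualityComplex π D d ω₀) (i : ℕ) (hi : i ≠ d) :
    ∃ (a : _ →ₗ[k⟦X⟧] _) (b : _ →ₗ[k⟦X⟧] _),
      colMap k (prevMatrix D i) ∘ₗ a + b ∘ₗ colMap k (D i) = LinearMap.id := by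
  refine exists_splitting (fun y hy => h.exists_prevMatrix_mulVec_eq i hi y hy)
    (h.exists_colMap_inverse_of_ne i hi) ?_
  by_cases hd : i + 1 = d
  · subst hd
    obtain ⟨-, -, -, -, -, -, -, -, ht⟩ := h.exists_generator
    exact ht
  · exact h.exists_colMap_inverse_of_ne (i + 1) hd

end IsDualityComplex

end DualComplex

/-! ### The complex of a Hopf algebra whose reduction satisfies duality -/

section ExtClass

open Matrix

namespace IsFreeResolution

variable {R : Type u} [Ring R] {n : ℕ → ℕ} {D : ∀ i, Matrix (Fin (n (i + 1))) (Fin (n i)) R}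
  {M : ModuleCat.{u} R} {aug : (Fin (n 0) → R) →ₗ[R] M}

theorem extClass_eq_iff (h : IsFreeResolution D aug) (i : ℕ) (y y' : Fin (n i) → R)
    (hy : D i *ᵥ y = 0) (hy' : D i *ᵥ y' = 0) :
    h.extClass i y hy = h.extClass i y' hy' ↔ ∃ z, prevMatrix D i *ᵥ z = y - y' := by
  have hs : D i *ᵥ (y - y') = 0 := by rw [mulVec_sub, hy, hy', sub_zero]
  rw [← h.extClass_eq_zero_iff i (y - y') hs, ← add_eq_right (b := h.extClass i y' hy'),
    ← h.extClass_add]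
  simp only [sub_add_cancel]

theorem mulVec_mul_eq_zero {m m' : ℕ} {E : Matrix (Fin m) (Fin m') R} {y : Fin m' → R}
    (hy : E *ᵥ y = 0) (a : R) : E *ᵥ (fun j => y j * a) = 0 := by
  funext i
  have := congrFun hy i
  simp only [mulVec, dotProduct] at this ⊢
  simp only [← mul_assoc]
  rw [← Finset.sum_mul, this, Pi.zero_apply, zero_mul]

theorem extClass_smul {S : Type u} [CommRing S] [Algebra S R] (h : IsFreeResolution D aug) (i : ℕ)
    (y : Fin (n i) → R) (hy : D i *ᵥ y = 0) (s : S) :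
    h.extClass i (fun j => y j * algebraMap S R s) (mulVec_mul_eq_zero hy _) =
      s • h.extClass i y hy :=
  h.extClass_mul i y hy _ _

/-- A complex whose reduction modulo `h` computes `Ext` groups that vanish except for a line in
degree `d`. -/
theorem exists_isDualityComplex {k A A₀ : Type u} [Field k] [Ring A] [Algebra k⟦X⟧ A] [Ring A₀]
    [Algebra k A₀] (π : Reduction k A A₀) {n : ℕ → ℕ}
    {D : ∀ i, Matrix (Fin (n (i + 1))) (Fin (n i)) A} {M : ModuleCat.{u} A}
    {aug : (Fin (n 0) → A) →ₗ[A] M} (h : IsFreeResolution D aug) {M₀ : ModuleCat.{u} A₀}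
    {aug₀ : (Fin (n 0) → A₀) →ₗ[A₀] M₀}
    (h₀ : IsFreeResolution (fun i => (D i).map π.proj) aug₀) (d : ℕ)
    (hExt : ∀ i, i ≠ d → Subsingleton (ExtReg A₀ M₀ i)) (e : ExtReg A₀ M₀ d ≃ₗ[k] k) :
    ∃ ω₀, IsDualityComplex π D d ω₀ := by
  -- `ω₀` represents the basis vector of `Ext^d` that corresponds to `1 ∈ k`.
  obtain ⟨ω₀, hω₀, he⟩ := h₀.extClass_surjective d (e.symm 1)
  refine ⟨ω₀, h.mul_prevMatrix, fun i hi y hy => ?_, hω₀, fun y hy => ?_, fun z hz => ?_⟩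
  · have := hExt i hi
    rw [← prevMatrix_map]
    exact (h₀.extClass_eq_zero_iff i y hy).mp (Subsingleton.elim _ _)
  · have h1 : h₀.extClass d y hy = e (h₀.extClass d y hy) • h₀.extClass d ω₀ hω₀ := by
      apply e.injective
      rw [he, map_smul, e.apply_symm_apply, smul_eq_mul, mul_one]
    rw [← extClass_smul, extClass_eq_iff, prevMatrix_map] at h1
    obtain ⟨z, hz⟩ := h1
    exact ⟨z, _, by rw [hz, sub_add_cancel]⟩
  · rw [← prevMatrix_map] at hz
    have h1 := (h₀.extClass_eq_zero_iff d ω₀ hω₀).mpr ⟨z, hz⟩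
    rw [he, e.symm.map_eq_zero_iff] at h1
    exact one_ne_zero h1

end IsFreeResolution

end ExtClass

/-! ### Generators of the dual complex -/

section Generator

open Matrix

variable {k A : Type u} [Field k] [Ring A] [Algebra k⟦X⟧ A] {n : ℕ → ℕ}

/-- A cocycle `ω` in degree `d`, together with a linear form `p` and a splitting which show that
the cohomology in degree `d` is freely generated by the class of `ω`. -/
structure IsGenerator (D : ∀ i, Matrix (Fin (n (i + 1))) (Fin (n i)) A) (d : ℕ)
    (ω : Fin (n d) → A) (p : (Fin (n d) → A) →ₗ[k⟦X⟧] k⟦X⟧) : Prop where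
  cocycle : D d *ᵥ ω = 0
  form_boundary : ∀ z, p (prevMatrix D d *ᵥ z) = 0
  form_self : p ω = 1
  exists_splitting : ∃ (a : (Fin (n d) → A) →ₗ[k⟦X⟧] (Fin (prevRank n d) → A))
    (b : (Fin (n (d + 1)) → A) →ₗ[k⟦X⟧] (Fin (n d) → A)),
      colMap k (prevMatrix D d) ∘ₗ a + b ∘ₗ colMap k (D d) +
        LinearMap.toSpanSingleton k⟦X⟧ _ ω ∘ₗ p = LinearMap.id

theorem mul_algebraMap_eq_smul {m : ℕ} (y : Fin m → A) (s : k⟦X⟧) :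
    (fun j => y j * algebraMap k⟦X⟧ A s) = s • y :=
  funext fun j => by rw [Pi.smul_apply, Algebra.smul_def, Algebra.commutes]

theorem mulVec_mul {m m' : ℕ} (E : Matrix (Fin m) (Fin m') A) (y : Fin m' → A) (a : A) :
    (E *ᵥ fun j => y j * a) = fun i => (E *ᵥ y) i * a :=
  funext fun i => by simp [mulVec, dotProduct, Finset.sum_mul, mul_assoc]

namespace IsGenerator

variable {D : ∀ i, Matrix (Fin (n (i + 1))) (Fin (n i)) A} {d : ℕ} {ω : Fin (n d) → A}
  {p : (Fin (n d) → A) →ₗ[k⟦X⟧] k⟦X⟧}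

theorem exists_prevMatrix_mulVec_eq (h : IsGenerator D d ω p) (y : Fin (n d) → A)
    (hy : D d *ᵥ y = 0) : ∃ z, prevMatrix D d *ᵥ z = y - p y • ω := by
  obtain ⟨a, b, hab⟩ := h.exists_splitting
  have h1 : prevMatrix D d *ᵥ a y + b (D d *ᵥ y) + p y • ω = y := LinearMap.congr_fun hab y
  rw [hy, map_zero, add_zero] at h1
  exact ⟨a y, eq_sub_of_add_eq h1⟩

variable {M : ModuleCat.{u} A} {aug : (Fin (n 0) → A) →ₗ[A] M}

theorem extClass_eq_smul (h : IsGenerator D d ω p) (hR : IsFreeResolution D aug)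
    (y : Fin (n d) → A) (hy : D d *ᵥ y = 0) :
    hR.extClass d y hy = p y • hR.extClass d ω h.cocycle := by
  rw [← hR.extClass_smul, hR.extClass_eq_iff, mul_algebraMap_eq_smul]
  exact h.exists_prevMatrix_mulVec_eq y hy

/-- The class of a generator is a basis of the cohomology. -/
def extEquiv (h : IsGenerator D d ω p) (hR : IsFreeResolution D aug) :
    k⟦X⟧ ≃ₗ[k⟦X⟧] ExtReg A M d :=
  LinearEquiv.ofBijective (LinearMap.toSpanSingleton k⟦X⟧ _ (hR.extClass d ω h.cocycle))
    ⟨(injective_iff_map_eq_zero _).mpr fun s hs => by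
      rw [LinearMap.toSpanSingleton_apply, ← hR.extClass_smul, hR.extClass_eq_zero_iff,
        mul_algebraMap_eq_smul] at hs
      obtain ⟨z, hz⟩ := hs
      have := h.form_boundary z
      rwa [hz, map_smul, h.form_self, smul_eq_mul, mul_one] at this,
    fun v => by
      obtain ⟨y, hy, rfl⟩ := hR.extClass_surjective d v
      exact ⟨p y, (h.extClass_eq_smul hR y hy).symm⟩⟩

/-- The character through which `A` acts on the class of a generator. -/
def char (h : IsGenerator D d ω p) : A →ₐ[k⟦X⟧] k⟦X⟧ :=
  AlgHom.ofLinearMap (p ∘ₗ LinearMap.pi fun j => LinearMap.mulLeft k⟦X⟧ (ω j))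
    (by
      refine Eq.trans (congrArg p (funext fun j => ?_)) h.form_self
      exact mul_one (ω j))
    (fun a b => by
      change p (fun j => ω j * (a * b)) = p (fun j => ω j * a) * p (fun j => ω j * b)
      -- `ω a` equals `p(ω a) ω` up to a boundary. Boundaries remain boundaries under right
      -- multiplication by `b`, and `p` kills them.
      obtain ⟨z, hz⟩ := h.exists_prevMatrix_mulVec_eq _
        (IsFreeResolution.mulVec_mul_eq_zero h.cocycle a)
      have h1 : (fun j => ω j * (a * b)) = (prevMatrix D d *ᵥ fun j => z j * b) +
          p (fun j => ω j * a) • fun j => ω j * b := by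
        rw [mulVec_mul, hz]
        funext j
        simp [sub_mul, mul_assoc]
      rw [h1, map_add, h.form_boundary, zero_add, map_smul, smul_eq_mul])

theorem char_apply (h : IsGenerator D d ω p) (a : A) : h.char a = p fun j => ω j * a := rfl

theorem op_smul (h : IsGenerator D d ω p) (hR : IsFreeResolution D aug) (a : A)
    (v : ExtReg A M d) : MulOpposite.op a • v = h.char a • v := by
  obtain ⟨s, rfl⟩ := (h.extEquiv hR).surjective v
  change MulOpposite.op a • s • hR.extClass d ω h.cocycle =
    h.char a • s • hR.extClass d ω h.cocycle
  have hs : D d *ᵥ (fun j => ω j * algebraMap k⟦X⟧ A s) = 0 :=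
    IsFreeResolution.mulVec_mul_eq_zero h.cocycle _
  rw [← hR.extClass_smul d ω h.cocycle,
    ← hR.extClass_mul d _ hs a (IsFreeResolution.mulVec_mul_eq_zero hs a), h.extClass_eq_smul hR,
    hR.extClass_smul d ω h.cocycle, smul_smul, char_apply]
  congr 1
  rw [mul_comm, ← smul_eq_mul, ← map_smul]
  congr 1
  funext j
  rw [Pi.smul_apply, ← Algebra.commutes, mul_assoc, Algebra.smul_def]

end IsGenerator

theorem IsDualityComplex.exists_isGenerator [IsAdicComplete (hIdeal k) A] [HTorsionFree k A]
    {A₀ : Type u} [Ring A₀] [Algebra k A₀] {π : Reduction k A A₀}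
    {D : ∀ i, Matrix (Fin (n (i + 1))) (Fin (n i)) A} {d : ℕ} {ω₀ : Fin (n d) → A₀}
    (h : IsDualityComplex π D d ω₀) :
    ∃ (ω : Fin (n d) → A) (p : (Fin (n d) → A) →ₗ[k⟦X⟧] k⟦X⟧), IsGenerator D d ω p := by
  obtain ⟨ω, p, a, b, h1, h2, h3, h4, -⟩ := h.exists_generator
  exact ⟨ω, p, h1, h2, h3, a, b, h4⟩

end Generator

/-! ### The dual complex over the enveloping algebra -/

section EnvDual

open Matrix

namespace TopHopf

variable {k A : Type u} [Field k] [Ring A] [Algebra k⟦X⟧ A] [IsAdicComplete (hIdeal k) A]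
  (H : TopHopf k A)

/-- The isomorphism `Aⁿ ⊗̂ Aᵒᵖ ≃ (A ⊗̂ Aᵒᵖ)ⁿ` with `x ⊗ y ↦ (δ(xᵢ) (1 ⊗ y))ᵢ`. -/
def colUntwist (n : ℕ) : CTensor k (Fin n → A) Aᵐᵒᵖ ≃ₗ[k⟦X⟧] (Fin n → Env k A) :=
  (CTensor.piEquiv k A Aᵐᵒᵖ n).trans (LinearEquiv.piCongrRight fun _ => H.leftUntwist)

theorem colUntwist_mk (n : ℕ) (x : Fin n → A) (y : Aᵐᵒᵖ) (i : Fin n) :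
    H.colUntwist n (CTensor.mk x y) i = H.delta (x i) * CTensor.mk (k := k) 1 y := by
  change H.leftUntwist (CTensor.piEquiv k A Aᵐᵒᵖ n (CTensor.mk x y) i) = _
  rw [CTensor.piEquiv_mk, leftUntwist_mk]

set_option synthInstance.maxHeartbeats 400000 in
theorem colUntwist_map {m n : ℕ} (D : Matrix (Fin m) (Fin n) A)
    (t : CTensor k (Fin n → A) Aᵐᵒᵖ) :
    H.colUntwist m (CTensor.map (colMap k D) LinearMap.id t) =
      D.map (H.delta : A →+* Env k A) *ᵥ H.colUntwist n t := by
  have : (H.colUntwist m).toLinearMap ∘ₗ CTensor.map (colMap k D) LinearMap.id =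
      colMap k (D.map (H.delta : A →+* Env k A)) ∘ₗ (H.colUntwist n).toLinearMap :=
    CTensor.hom_ext fun x y => funext fun j => by
      simp only [LinearMap.comp_apply, CTensor.map_mk, LinearMap.id_apply, LinearEquiv.coe_coe,
        colUntwist_mk, colMap_apply, mulVec, dotProduct, map_sum, map_mul, Finset.sum_mul,
        mul_assoc]
      rfl
  exact LinearMap.congr_fun this t

/-- The map `(A ⊗̂ Aᵒᵖ)ⁿ → A` with `(δ(xᵢ) (1 ⊗ y))ᵢ ↦ p(x) y` induced by a linear form `p`. -/
def envForm {n : ℕ} (p : (Fin n → A) →ₗ[k⟦X⟧] k⟦X⟧) : (Fin n → Env k A) →ₗ[k⟦X⟧] A :=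
  (CTensor.lidEquiv k A).toLinearMap ∘ₗ
    CTensor.map p (MulOpposite.opLinearEquiv k⟦X⟧).symm.toLinearMap ∘ₗ
      (H.colUntwist n).symm.toLinearMap

theorem envForm_colUntwist {n : ℕ} (p : (Fin n → A) →ₗ[k⟦X⟧] k⟦X⟧)
    (t : CTensor k (Fin n → A) Aᵐᵒᵖ) : H.envForm p (H.colUntwist n t) =
      CTensor.lidEquiv k A
        (CTensor.map p (MulOpposite.opLinearEquiv k⟦X⟧).symm.toLinearMap t) := by
  simp only [envForm, LinearMap.comp_apply, LinearEquiv.coe_coe, LinearEquiv.symm_apply_apply]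

theorem envForm_delta_mul {n : ℕ} (p : (Fin n → A) →ₗ[k⟦X⟧] k⟦X⟧) (x : Fin n → A) (y : A) :
    H.envForm p (fun i => H.delta (x i) * CTensor.mk (k := k) 1 (MulOpposite.op y)) =
      p x • y := by
  have := H.envForm_colUntwist p (CTensor.mk x (MulOpposite.op y))
  rw [CTensor.map_mk, CTensor.lidEquiv_mk] at this
  rw [← funext (H.colUntwist_mk n x (MulOpposite.op y)), this]
  rfl

theorem envForm_mulVec {m n : ℕ} {p : (Fin n → A) →ₗ[k⟦X⟧] k⟦X⟧} {E : Matrix (Fin n) (Fin m) A}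
    (hp : ∀ z, p (E *ᵥ z) = 0) (z : Fin m → Env k A) :
    H.envForm p (E.map (H.delta : A →+* Env k A) *ᵥ z) = 0 := by
  obtain ⟨t, rfl⟩ := (H.colUntwist m).surjective z
  have h1 : p ∘ₗ colMap k E = 0 := LinearMap.ext hp
  have h2 : CTensor.map p (MulOpposite.opLinearEquiv k⟦X⟧).symm.toLinearMap ∘ₗ
      CTensor.map (colMap k E) (LinearMap.id : Aᵐᵒᵖ →ₗ[k⟦X⟧] Aᵐᵒᵖ) = 0 := by
    rw [← CTensor.map_comp, h1, CTensor.map_zero_left]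
  have h3 := LinearMap.congr_fun h2 t
  rw [LinearMap.comp_apply, LinearMap.zero_apply] at h3
  rw [← colUntwist_map, envForm_colUntwist, h3, map_zero]

/-- A homotopy over `K` survives `⊗̂ Aᵒᵖ`, and `colUntwist` carries the result to the dual complex
over the enveloping algebra. -/
theorem exists_mulVec_eq_of_splitting {l m n : ℕ} {E : Matrix (Fin m) (Fin l) A}
    {F : Matrix (Fin n) (Fin m) A}
    (h : ∃ (a : (Fin m → A) →ₗ[k⟦X⟧] (Fin l → A)) (b : (Fin n → A) →ₗ[k⟦X⟧] (Fin m → A)),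
      colMap k E ∘ₗ a + b ∘ₗ colMap k F = LinearMap.id)
    (y : Fin m → Env k A) (hy : F.map (H.delta : A →+* Env k A) *ᵥ y = 0) :
    ∃ z, E.map (H.delta : A →+* Env k A) *ᵥ z = y := by
  obtain ⟨t, rfl⟩ := (H.colUntwist m).surjective y
  rw [← colUntwist_map, LinearEquiv.map_eq_zero_iff] at hy
  obtain ⟨s, rfl⟩ := CTensor.exists_map_eq h t hy
  exact ⟨H.colUntwist l s, (H.colUntwist_map _ _).symm⟩

end TopHopf

namespace IsGenerator

variable {k A : Type u} [Field k] [Ring A] [Algebra k⟦X⟧ A] [IsAdicComplete (hIdeal k) A]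
  (H : TopHopf k A) {n : ℕ → ℕ} {D : ∀ i, Matrix (Fin (n (i + 1))) (Fin (n i)) A} {d : ℕ}
  {ω : Fin (n d) → A} {p : (Fin (n d) → A) →ₗ[k⟦X⟧] k⟦X⟧}

theorem env_cocycle (h : IsGenerator D d ω p) (y : Aᵐᵒᵖ) :
    (D d).map (H.delta : A →+* Env k A) *ᵥ H.colUntwist (n d) (CTensor.mk ω y) = 0 := by
  rw [← TopHopf.colUntwist_map, CTensor.map_mk, colMap_apply, h.cocycle, map_zero,
    LinearMap.zero_apply]
  exact LinearEquiv.map_zero _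

/-- Tensor the splitting in degree `d` with `Aᵒᵖ` and evaluate it on a cocycle: the term with the
outgoing differential drops out, and the term `ω p` becomes `ω ⊗ envForm p y`. -/
theorem exists_env_mulVec_eq (h : IsGenerator D d ω p) (y : Fin (n d) → Env k A)
    (hy : (D d).map (H.delta : A →+* Env k A) *ᵥ y = 0) :
    ∃ z, (prevMatrix D d).map (H.delta : A →+* Env k A) *ᵥ z =
      y - H.colUntwist (n d) (CTensor.mk ω (MulOpposite.op (H.envForm p y))) := by
  obtain ⟨a, b, hab⟩ := h.exists_splitting
  obtain ⟨t, rfl⟩ := (H.colUntwist (n d)).surjective y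
  rw [← TopHopf.colUntwist_map, LinearEquiv.map_eq_zero_iff] at hy
  have h1 : CTensor.map (LinearMap.toSpanSingleton k⟦X⟧ _ ω ∘ₗ p) LinearMap.id =
      CTensor.mk (k := k) ω ∘ₗ (MulOpposite.opLinearEquiv k⟦X⟧).toLinearMap ∘ₗ
        (CTensor.lidEquiv k A).toLinearMap ∘ₗ
          CTensor.map p (MulOpposite.opLinearEquiv k⟦X⟧).symm.toLinearMap :=
    CTensor.hom_ext fun x y => by simp
  have h2 : CTensor.map (colMap k (prevMatrix D d)) LinearMap.id ∘ₗ CTensor.map a LinearMap.id +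
      CTensor.map b LinearMap.id ∘ₗ CTensor.map (colMap k (D d)) LinearMap.id +
      CTensor.map (LinearMap.toSpanSingleton k⟦X⟧ _ ω ∘ₗ p) LinearMap.id =
        (LinearMap.id : CTensor k (Fin (n d) → A) Aᵐᵒᵖ →ₗ[k⟦X⟧] _) := by
    rw [← CTensor.map_comp, ← CTensor.map_comp, LinearMap.comp_id, ← CTensor.map_add_left,
      ← CTensor.map_add_left, hab, CTensor.map_id]
  have h3 := LinearMap.congr_fun h2 t
  rw [h1, LinearMap.add_apply, LinearMap.add_apply, LinearMap.comp_apply, LinearMap.comp_apply,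
    hy, map_zero, add_zero] at h3
  refine ⟨H.colUntwist _ (CTensor.map a LinearMap.id t), ?_⟩
  rw [← TopHopf.colUntwist_map, TopHopf.envForm_colUntwist]
  exact (congrArg _ (eq_sub_of_add_eq h3)).trans ((H.colUntwist (n d)).map_sub _ _)

end IsGenerator

end EnvDual

/-! ### Hochschild cohomology -/

section Hochschild

open Matrix

/-- The linear map `z ↦ (uⱼ z c)ⱼ`. -/
def mulLeftRight {S E : Type*} [CommRing S] [Ring E] [Algebra S E] {m : ℕ} (u : Fin m → E) (c : E) :
    E →ₗ[S] (Fin m → E) where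
  toFun z j := u j * z * c
  map_add' x y := by
    funext j
    simp [mul_add, add_mul]
  map_smul' s x := by
    funext j
    simp

variable {k A : Type u} [Field k] [Ring A] [Algebra k⟦X⟧ A] [IsAdicComplete (hIdeal k) A]
  (H : TopHopf k A) {n : ℕ → ℕ} {D : ∀ i, Matrix (Fin (n (i + 1))) (Fin (n i)) A} {d : ℕ}
  {ω : Fin (n d) → A} {p : (Fin (n d) → A) →ₗ[k⟦X⟧] k⟦X⟧}

namespace IsGenerator

/-- For `t = x ⊗ y` the argument is `δ(ω x) (1 ⊗ c S²(y))`, whose value is `θ(x) c S²(y) = c S(θ(x)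
S(y))`. -/
theorem envForm_mulLift (h : IsGenerator D d ω p) (t : CTensor k A A) (c : A) :
    H.envForm p (fun j => H.delta (ω j) * CTensor.mulLift H.delta.toLinearMap
      ((CTensor.inr k A Aᵐᵒᵖ).toLinearMap ∘ₗ H.antipodeOp.toLinearMap ∘ₗ H.antipode) t *
        CTensor.mk (k := k) 1 (MulOpposite.op c)) =
      c * H.antipode (CTensor.lift ((LinearMap.lsmul k⟦X⟧ A).compl₁₂ h.char.toLinearMap
        H.antipode) t) := by
  let f : CTensor k A A →ₗ[k⟦X⟧] A :=
    H.envForm p ∘ₗ mulLeftRight (fun j => H.delta (ω j))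
      (CTensor.mk (k := k) 1 (MulOpposite.op c) : Env k A) ∘ₗ
        CTensor.mulLift H.delta.toLinearMap
          ((CTensor.inr k A Aᵐᵒᵖ).toLinearMap ∘ₗ H.antipodeOp.toLinearMap ∘ₗ H.antipode)
  have : f = LinearMap.mulLeft k⟦X⟧ c ∘ₗ H.antipode ∘ₗ
      CTensor.lift ((LinearMap.lsmul k⟦X⟧ A).compl₁₂ h.char.toLinearMap H.antipode) := by
    refine CTensor.hom_ext fun x y => ?_
    have h1 (j : Fin (n d)) : H.delta (ω j) * CTensor.mulLift H.delta.toLinearMap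
        ((CTensor.inr k A Aᵐᵒᵖ).toLinearMap ∘ₗ H.antipodeOp.toLinearMap ∘ₗ H.antipode)
          (CTensor.mk x y) * CTensor.mk (k := k) 1 (MulOpposite.op c) =
        H.delta (ω j * x) *
          CTensor.mk (k := k) 1 (MulOpposite.op (c * H.antipode (H.antipode y))) := by
      rw [CTensor.mulLift_mk, map_mul, mul_assoc, mul_assoc, mul_assoc]
      congr 2
      change CTensor.mk (k := k) 1 (MulOpposite.op (H.antipode (H.antipode y))) *
        CTensor.mk (k := k) 1 (MulOpposite.op c) = _
      rw [CTensor.mk_mul_mk, one_mul, MulOpposite.op_mul]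
    refine (congrArg (H.envForm p) (funext h1)).trans ?_
    rw [H.envForm_delta_mul]
    simp [char_apply]
  exact LinearMap.congr_fun this t

/-- For `z = α ⊗ β` the flip is `β ⊗ α`. Write `β ⊗ 1 = ∑ δ(β') (1 ⊗ S²(β''))` and absorb `δ(β')`
into `δ(ω)`, which produces `θ(β')`. The value is `∑ θ(β') α S(x) S²(β'') = S(∑ θ(β') S(β'') x
S⁻¹(α))`. -/
theorem envForm_mul_envFlip (hS : Function.Bijective H.antipode) (h : IsGenerator D d ω p)
    (z : Env k A) (x : A) :
    H.envForm p (fun j => H.colUntwist (n d)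
      (CTensor.mk ω (MulOpposite.op (H.antipode x))) j * envFlip k A z) =
      H.antipode (H.twistedAct hS h.char z x) := by
  let f : Env k A →ₗ[k⟦X⟧] A := H.envForm p ∘ₗ mulLeftRight
    (H.colUntwist (n d) (CTensor.mk ω (MulOpposite.op (H.antipode x)))) (1 : Env k A) ∘ₗ
      envFlip k A
  have : f = H.antipode ∘ₗ (H.twistedAct hS h.char).flip x := by
    refine CTensor.hom_ext fun α β => ?_
    obtain ⟨β, rfl⟩ := MulOpposite.op_surjective β
    have h1 (j : Fin (n d)) : H.colUntwist (n d)
        (CTensor.mk ω (MulOpposite.op (H.antipode x))) j *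
          envFlip k A (CTensor.mk α (MulOpposite.op β)) * 1 =
        H.delta (ω j) * CTensor.mulLift H.delta.toLinearMap
          ((CTensor.inr k A Aᵐᵒᵖ).toLinearMap ∘ₗ H.antipodeOp.toLinearMap ∘ₗ H.antipode)
            (H.comul β) * CTensor.mk (k := k) 1 (MulOpposite.op (α * H.antipode x)) := by
      rw [H.lift_delta_comul, H.colUntwist_mk, envFlip_mk, mul_one, mul_assoc, mul_assoc,
        CTensor.mk_mul_mk, CTensor.mk_mul_mk]
      simp
    refine (congrArg (H.envForm p) (funext h1)).trans ?_
    rw [h.envForm_mulLift, LinearMap.comp_apply, LinearMap.flip_apply, TopHopf.twistedAct_mk,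
      H.antipode_mul_rev, H.antipode_mul_rev]
    have h2 : H.antipode (H.antipodeInv hS α) = α :=
      (LinearEquiv.ofBijective H.antipode hS).apply_symm_apply α
    rw [h2]
    rfl
  refine Eq.trans (congrArg (H.envForm p) (funext fun j => ?_)) (LinearMap.congr_fun this z)
  exact (mul_one _).symm

variable {c : Fin (n 0) → k⟦X⟧}

/-- The class in `HH^d(A ⊗̂ A)` that corresponds to `x ∈ A`. -/
def hhClass (h : IsGenerator D d ω p)
    (hE : IsFreeResolution (fun i => (D i).map (H.delta : A →+* Env k A)) (TopHopf.envAug A c)) :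
    A →ₗ[k⟦X⟧] HHOuter k A d where
  -- Parametrizing by `S(x)` instead of `x` turns the action `y ↦ ∑ θ(β') α y S²(β'')` on the second
  -- factor into the twisted action.
  toFun x := hE.extClass d (H.colUntwist (n d) (CTensor.mk ω (MulOpposite.op (H.antipode x))))
    (h.env_cocycle H _)
  map_add' x y := by
    rw [← hE.extClass_add]
    congr 1
    rw [map_add, MulOpposite.op_add, map_add]
    exact LinearEquiv.map_add _ _ _
  map_smul' s x := by
    rw [RingHom.id_apply, ← hE.extClass_smul]
    congr 1
    rw [map_smul, MulOpposite.op_smul, map_smul, mul_algebraMap_eq_smul]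
    exact LinearEquiv.map_smul _ _ _

theorem extClass_eq_hhClass (h : IsGenerator D d ω p)
    (hE : IsFreeResolution (fun i => (D i).map (H.delta : A →+* Env k A)) (TopHopf.envAug A c))
    (y : Fin (n d) → Env k A) (hy : (D d).map (H.delta : A →+* Env k A) *ᵥ y = 0) (x : A)
    (hx : H.antipode x = H.envForm p y) : hE.extClass d y hy = h.hhClass H hE x := by
  refine (hE.extClass_eq_iff d _ _ hy (h.env_cocycle H _)).mpr ?_
  rw [prevMatrix_map, hx]
  exact h.exists_env_mulVec_eq H y hy

/-- `envForm p` kills boundaries and recovers `S(x)` from the class of `x`, so `x` is determined as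
`S` is injective. Every cocycle `y` is cohomologous to `ω ⊗ envForm p y`, and `S` is surjective. -/
theorem hhClass_bijective (hS : Function.Bijective H.antipode) (h : IsGenerator D d ω p)
    (hE : IsFreeResolution (fun i => (D i).map (H.delta : A →+* Env k A)) (TopHopf.envAug A c)) :
    Function.Bijective (h.hhClass H hE) := by
  constructor
  · refine (injective_iff_map_eq_zero _).mpr fun x hx => ?_
    obtain ⟨z, hz⟩ := (hE.extClass_eq_zero_iff d _ (h.env_cocycle H _)).mp hx
    rw [prevMatrix_map] at hz
    have h1 := H.envForm_mulVec h.form_boundary z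
    rw [hz, H.envForm_colUntwist, CTensor.map_mk, CTensor.lidEquiv_mk, h.form_self, one_smul]
      at h1
    exact hS.injective (h1.trans (map_zero _).symm)
  · intro v
    obtain ⟨y, hy, rfl⟩ := hE.extClass_surjective d v
    obtain ⟨x, hx⟩ := hS.surjective (H.envForm p y)
    exact ⟨x, (h.extClass_eq_hhClass H hE y hy x hx).symm⟩

theorem smul_hhClass (hS : Function.Bijective H.antipode) (h : IsGenerator D d ω p)
    (hE : IsFreeResolution (fun i => (D i).map (H.delta : A →+* Env k A)) (TopHopf.envAug A c))
    (z : Env k A) (x : A) :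
    z • h.hhClass H hE x = h.hhClass H hE (H.twistedAct hS h.char z x) := by
  refine Eq.trans ?_ (h.extClass_eq_hhClass H hE _
    (IsFreeResolution.mulVec_mul_eq_zero (h.env_cocycle H _) (envFlip k A z)) _
      (h.envForm_mul_envFlip H hS z x).symm)
  exact (hE.extClass_mul d _ (h.env_cocycle H _) _ _).symm

theorem exists_hhEquiv (hS : Function.Bijective H.antipode) (h : IsGenerator D d ω p)
    (hR : IsFreeResolution D (charAug (H.counit : A →+* k⟦X⟧) c))
    (hE : IsFreeResolution (fun i => (D i).map (H.delta : A →+* Env k A)) (TopHopf.envAug A c)) :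
    ∃ e : HHOuter k A d ≃ₗ[k⟦X⟧] H.Omega d ⊗[k⟦X⟧] A,
      ∀ (z : Env k A) (v : HHOuter k A d), e (z • v) = H.omegaAct hS h.char d z (e v) := by
  let g := LinearEquiv.ofBijective _ (h.hhClass_bijective H hS hE)
  let f : A ≃ₗ[k⟦X⟧] H.Omega d ⊗[k⟦X⟧] A :=
    (TensorProduct.lid k⟦X⟧ A).symm.trans (TensorProduct.congr (h.extEquiv hR) (.refl _ _))
  -- `omegaAct` acts on the second factor only, and `f x` is the class of `ω` tensored with `x`.
  have hf (z : Env k A) (x : A) :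
      f (H.twistedAct hS h.char z x) = H.omegaAct hS h.char d z (f x) := rfl
  refine ⟨g.symm.trans f, fun z v => ?_⟩
  obtain ⟨x, rfl⟩ := g.surjective v
  have h1 : z • g x = g (H.twistedAct hS h.char z x) := h.smul_hhClass H hS hE z x
  rw [h1]
  change f (g.symm (g _)) = H.omegaAct hS h.char d z (f (g.symm (g x)))
  rw [g.symm_apply_apply, g.symm_apply_apply, hf]

end IsGenerator

end Hochschild

end

end QDuality

/-! ### Assembly of the duality theorem. -/

open scoped TensorProduct PowerSeries in
open QDuality in
theorem mainTheorem5 {k A₀ A : Type u} [Field k] [CharZero k]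
    [Ring A₀] [Algebra k A₀] [Ring A] [Algebra k⟦X⟧ A] [IsTopologicallyFree k A]
    (π : Reduction k A A₀)
    (H : TopHopf k A) (hS : Function.Bijective H.antipode)
    [IsNoetherianRing A₀] [IsNoetherianRing (A₀ ⊗[k] A₀ᵐᵒᵖ)]
    (ε₀ : A₀ →ₐ[k] k)
    (hε₀ : ∀ a : A, ε₀ (π.proj a) = PowerSeries.constantCoeff (H.counit a))
    (d : ℕ)
    (hExt : ∀ i, i ≠ d → Subsingleton (ExtReg A₀ (moduleOfChar (ε₀ : A₀ →+* k)) i))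
    (hExtd : Nonempty (ExtReg A₀ (moduleOfChar (ε₀ : A₀ →+* k)) d ≃ₗ[k] k)) :
    (∀ i, i ≠ d → Subsingleton (HochschildCohomology k A (Outer k A) i)) ∧
    Nonempty (H.Omega d ≃ₗ[k⟦X⟧] k⟦X⟧) ∧
    ∃ θ : A →ₐ[k⟦X⟧] k⟦X⟧,
      (∀ (a : A) (ω : H.Omega d), MulOpposite.op a • ω = θ a • ω) ∧
      ∃ e : HHOuter k A d ≃ₗ[k⟦X⟧] H.Omega d ⊗[k⟦X⟧] A,
        ∀ (z : Env k A) (v : HHOuter k A d), e (z • v) = H.omegaAct hS θ d z (e v) := by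
  have : HTorsionFree k A := IsTopologicallyFree.hTorsionFree
  obtain ⟨n, D, c, hR⟩ := π.exists_freeResolution H.counit
  obtain ⟨e⟩ := hExtd
  obtain ⟨ω₀, hD⟩ :=
    hR.exists_isDualityComplex π (π.isFreeResolution_map H.counit ε₀ hε₀ hR) d hExt e
  obtain ⟨ω, p, h⟩ := hD.exists_isGenerator
  have hE := H.isFreeResolution_env hR
  refine ⟨fun i hi => subsingleton_of_forall_eq 0 fun v => ?_, ⟨(h.extEquiv hR).symm⟩, h.char,
    h.op_smul hR, h.exists_hhEquiv H hS hR hE⟩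
  -- Outside degree `d` the dual complex over `A` is split exact, so every cocycle over the
  -- enveloping algebra is a boundary.
  obtain ⟨y, hy, rfl⟩ := hE.extClass_surjective i v
  refine (hE.extClass_eq_zero_iff i y hy).mpr ?_
  rw [prevMatrix_map]
  exact H.exists_mulVec_eq_of_splitting (hD.exists_splitting_of_ne i hi) y hy
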